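/- \textbf{Setting.} A Blotto game on $n\ge 2$ battlefields is given by values $v_{A,i}>0$, $v_{B,i}>0$ ($i\in[n]$) with $\sum_i v_{A,i}=\sum_i v_{B,i}=1$ and budgets $T_A\ge T_B>0$. A mixed strategy of player $P\in\{A,B\}$ is the law of a random vector $X_P\in[0,\infty)^n$ with $\sum_i X_{P,i}\le T_P$ almost surely; the players draw independently, and player $P$ receives $v_{P,i}$ on each battlefield $i$ where its allocation is strictly larger. On a tie at battlefield $i$, player $A$ receives $\tau_i v_{A,i}$ and player $B$ receives $(1-\tau_i)v_{B,i}$, where $\tau\in[0,1]^n$ is an arbitrary tie-breaking rule. Let $\gamma>0$ and $\lambda>0$ be parameters of a solution of the associated Lotto game, that is, $$\lambda T_A=\frac12\sum_{i=1}^n(\gamma v_{B,i})\wedge\frac{v_{A,i}^2}{\gamma v_{B,i}},\qquad \lambda T_B=\frac12\sum_{i=1}^n\frac{(\gamma v_{B,i})^2}{v_{A,i}}\wedge v_{A,i}.$$ The Lotto marginals are: if $v_{A,i}/v_{B,i}\ge\gamma$, the law $\mathsf{Unif}[0,\gamma v_{B,i}/\lambda]$ for $A$ and $\bigl(1-\frac{\gamma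 v_{B,i}}{v_{A,i}}\bigr)\delta_0+\frac{\gamma v_{B,i}}{v_{A,i}}\mathsf{Unif}[0,\gamma v_{B,i}/\lambda]$ for $B$; otherwise $\bigl(1-\frac{v_{A,i}}{\gamma v_{B,i}}\bigr)\delta_0+\frac{v_{A,i}}{\gamma v_{B,i}}\mathsf{Unif}[0,v_{A,i}/\lambda]$ for $A$ and $\mathsf{Unif}[0,v_{A,i}/\lambda]$ for $B$. A probability measure on $\mathbb R^n$ whose marginals have finite expectations is a joint mix if the sum of the coordinates is almost surely equal to the sum of their expectations. \textbf{Lemma.} Assume the mixability condition $$\max_{i\in[n]}\bigl(\gamma v_{B,i}\wedge v_{A,i}\bigr)\le\lambda T_B .$$ Then there exist probability measures $\pi_1,\dots,\pi_n$ on $\mathbb R^n$, weights $q_1,\dots,q_n\ge0$ with $\sum_k q_k=1$, and numbers $p^{(k)}_i\in[0,1]$ ($i,k\in[n]$) such that: \begin{enumerate} \item for all $k,i$ the $i$-th marginal of $\pi_k$ is $(1-p^{(k)}_i)\delta_0+p^{(k)}_i\,\mathsf{Unif}\bigl[0,\frac{v_{A,i}\wedge(\gamma v_{B,i})}{\lambda}\bigr]$,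 and for each $k$ at most one of $p^{(k)}_1,\dots,p^{(k)}_n$ lies in $(0,1)$; \item each $\pi_k$ is a joint mix; \item the mixture $\pi=\sum_{k=1}^n q_k\pi_k$ has the Lotto marginals of player $A$, is a joint mix, and is a solution of the Blotto game: there is a coupling $\nu$ of the Lotto marginals of player $B$ such that, for every tie-breaking rule $\tau$, the pair $(\pi,\nu)$ is a Nash equilibrium of the Blotto game; \item the weights $q_k$ and $p^{(k)}_i$, $i,k\in[n]$, are computed in $\mathcal O(n^2\log n)$ steps: there are a single program for the real RAM (unit-cost exact real arithmetic and comparisons, integer counters and addresses) and an absolute constant $C$ such that for all $n$ and all data as above the program, given $n,v_A,v_B,T_A,T_B,\gamma,\lambda$, outputs such weights after at most $C\,n^2\log n$ steps. \end{enumerate} -/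

import Mathlib

open MeasureTheory ProbabilityTheory

noncomputable section

/-! ### The Blotto game -/

/-- The datum of a Blotto game on `n` battlefields: values `vA i`, `vB i` of battlefield `i` for
the two players (normalised to total value one) and budgets `TA ≥ TB > 0`. -/
structure BlottoGame (n : ℕ) where
  vA : Fin n → ℝ
  vB : Fin n → ℝ
  TA : ℝ
  TB : ℝ
  vA_pos : ∀ i, 0 < vA i
  vB_pos : ∀ i, 0 < vB i
  TB_pos : 0 < TB
  TB_le_TA : TB ≤ TA
  sum_vA : ∑ i, vA i = 1
  sum_vB : ∑ i, vB i = 1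

/-- An admissible mixed strategy with budget `T`: the law of a random nonnegative allocation whose
total is almost surely at most `T`. -/
structure IsBlottoStrategy {n : ℕ} (T : ℝ) (μ : Measure (Fin n → ℝ)) : Prop where
  isProb : IsProbabilityMeasure μ
  nonneg : ∀ᵐ x ∂μ, ∀ i, 0 ≤ x i
  budget : ∀ᵐ x ∂μ, ∑ i, x i ≤ T

/-- The share of a battlefield won by allocating `x` against `y`, when a tie gives the share `s`. -/
def winShare (s x y : ℝ) : ℝ :=
  if y < x then 1 else if x = y then s else 0

namespace BlottoGame

variable {n : ℕ} (G : BlottoGame n)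

/-- Expected payoff of player `A` when `A` plays `μ` and `B` plays `ν` independently. On a tie at
battlefield `i`, player `A` gets the share `τ i` of it, and player `B` the share `1 - τ i`. -/
def payoffA (τ : Fin n → ℝ) (μ ν : Measure (Fin n → ℝ)) : ℝ :=
  ∫ z, ∑ i, G.vA i * winShare (τ i) (z.1 i) (z.2 i) ∂(μ.prod ν)

/-- Expected payoff of player `B`. -/
def payoffB (τ : Fin n → ℝ) (μ ν : Measure (Fin n → ℝ)) : ℝ :=
  ∫ z, ∑ i, G.vB i * winShare (1 - τ i) (z.2 i) (z.1 i) ∂(μ.prod ν)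

/-- `(μ, ν)` is a Nash equilibrium of the Blotto game with tie-breaking rule `τ`. -/
structure IsBlottoNash (τ : Fin n → ℝ) (μ ν : Measure (Fin n → ℝ)) : Prop where
  stratA : IsBlottoStrategy G.TA μ
  stratB : IsBlottoStrategy G.TB ν
  bestA : ∀ μ', IsBlottoStrategy G.TA μ' → G.payoffA τ μ' ν ≤ G.payoffA τ μ ν
  bestB : ∀ ν', IsBlottoStrategy G.TB ν' → G.payoffB τ μ ν' ≤ G.payoffB τ μ ν

end BlottoGame

/-! ### The Lotto solution -/

/-- The mixture `(1 - p) δ₀ + p Unif[0, b]`. -/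
def zeroUnifMix (p b : ℝ) : Measure ℝ :=
  ENNReal.ofReal (1 - p) • Measure.dirac 0 +
    ENNReal.ofReal p • ProbabilityTheory.cond volume (Set.Icc 0 b)

namespace BlottoGame

variable {n : ℕ} (G : BlottoGame n)

/-- `(γ, λ)` (written `g`, `l`) are the parameters of a solution of the associated Lotto game: they
solve the two equations which say that both expected budget constraints are saturated. -/
structure IsLottoParam (g l : ℝ) : Prop where
  g_pos : 0 < g
  l_pos : 0 < l
  budgetA : l * G.TA = (1 / 2) * ∑ i, min (g * G.vB i) ((G.vA i) ^ 2 / (g * G.vB i))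
  budgetB : l * G.TB = (1 / 2) * ∑ i, min ((g * G.vB i) ^ 2 / G.vA i) (G.vA i)

open Classical in
/-- The law prescribed to player `A` on battlefield `i` by the Lotto solution. -/
def lottoMarginalA (g l : ℝ) (i : Fin n) : Measure ℝ :=
  if g ≤ G.vA i / G.vB i then
    ProbabilityTheory.cond volume (Set.Icc 0 (g * G.vB i / l))
  else
    zeroUnifMix (G.vA i / (g * G.vB i)) (G.vA i / l)

open Classical in
/-- The law prescribed to player `B` on battlefield `i` by the Lotto solution. -/
def lottoMarginalB (g l : ℝ) (i : Fin n) : Measure ℝ :=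
  if g ≤ G.vA i / G.vB i then
    zeroUnifMix (g * G.vB i / G.vA i) (g * G.vB i / l)
  else
    ProbabilityTheory.cond volume (Set.Icc 0 (G.vA i / l))

end BlottoGame

/-- The probability measure `μ` on `ℝⁿ` is a coupling of the laws `P i`. -/
structure IsCoupling {n : ℕ} (μ : Measure (Fin n → ℝ)) (P : Fin n → Measure ℝ) : Prop where
  isProb : IsProbabilityMeasure μ
  marginal : ∀ i, μ.map (fun x => x i) = P i

/-- `μ` is a joint mix: its marginals have finite expectations and the sum of the coordinates is
almost surely equal to the sum of these expectations. -/
structure IsJointMix {n : ℕ} (μ : Measure (Fin n → ℝ)) : Prop where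
  isProb : IsProbabilityMeasure μ
  integrable : ∀ i, Integrable (fun x => x i) μ
  sum_eq : ∀ᵐ x ∂μ, ∑ i, x i = ∑ i, ∫ y, y i ∂μ

/-! ### A real RAM with unit costs

Programs work on natural-number registers (used for counters and addresses) and on arrays of exact
real numbers. There is no conversion between the two kinds of data. -/

namespace RealRAM

/-- The memory: register `r` holds `nat r`, and cell `j` of array `a` holds `real a j`. -/
structure State where
  nat : ℕ → ℕ
  real : ℕ → ℕ → ℝ

/-- An operand: the cell of array `arr` whose index is the content of register `reg`. -/
structure Cell where
  arr : ℕ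
  reg : ℕ

def State.get (s : State) (c : Cell) : ℝ := s.real c.arr (s.nat c.reg)

def State.setNat (s : State) (r v : ℕ) : State :=
  { s with nat := Function.update s.nat r v }

def State.setReal (s : State) (c : Cell) (v : ℝ) : State :=
  { s with
    real := Function.update s.real c.arr (Function.update (s.real c.arr) (s.nat c.reg) v) }

/-- Operations on registers (subtraction is truncated). -/
inductive NatOp
  | add
  | sub

def NatOp.eval : NatOp → ℕ → ℕ → ℕ
  | .add, x, y => x + y
  | .sub, x, y => x - y

/-- Exact arithmetic operations on real cells. -/
inductive RealOp
  | add
  | sub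
  | mul
  | div

def RealOp.eval : RealOp → ℝ → ℝ → ℝ
  | .add, x, y => x + y
  | .sub, x, y => x - y
  | .mul, x, y => x * y
  | .div, x, y => x / y

/-- A division by zero is not executable. -/
def RealOp.Defined : RealOp → ℝ → Prop
  | .div, y => y ≠ 0
  | _, _ => True

/-- Tests: strict comparison of two registers, or of two real cells. -/
inductive Test
  | natLt (r r' : ℕ)
  | realLt (c c' : Cell)

def Test.Holds (s : State) : Test → Prop
  | .natLt r r' => s.nat r < s.nat r'
  | .realLt c c' => s.get c < s.get c'

/-- Programs. -/
inductive Prog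
  | skip
  | natConst (r v : ℕ)
  | natOp (o : NatOp) (r r₁ r₂ : ℕ)
  | realConst (c : Cell) (v : ℚ)
  | realCopy (c c₁ : Cell)
  | realOp (o : RealOp) (c c₁ c₂ : Cell)
  | seq (P Q : Prog)
  | branch (b : Test) (P Q : Prog)
  | loop (b : Test) (P : Prog)

/-- `Exec P s t s'`: started in memory `s`, program `P` halts after exactly `t` steps in memory
`s'`. Each elementary instruction and each evaluation of a test is one step. -/
inductive Exec : Prog → State → ℕ → State → Prop
  | skip (s : State) : Exec .skip s 1 s
  | natConst (r v : ℕ) (s : State) : Exec (.natConst r v) s 1 (s.setNat r v)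
  | natOp (o : NatOp) (r r₁ r₂ : ℕ) (s : State) :
      Exec (.natOp o r r₁ r₂) s 1 (s.setNat r (o.eval (s.nat r₁) (s.nat r₂)))
  | realConst (c : Cell) (v : ℚ) (s : State) :
      Exec (.realConst c v) s 1 (s.setReal c (v : ℝ))
  | realCopy (c c₁ : Cell) (s : State) : Exec (.realCopy c c₁) s 1 (s.setReal c (s.get c₁))
  | realOp (o : RealOp) (c c₁ c₂ : Cell) (s : State) (h : o.Defined (s.get c₂)) :
      Exec (.realOp o c c₁ c₂) s 1 (s.setReal c (o.eval (s.get c₁) (s.get c₂)))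
  | seq {P Q : Prog} {s s₁ s₂ : State} {t t' : ℕ} (hP : Exec P s t s₁) (hQ : Exec Q s₁ t' s₂) :
      Exec (.seq P Q) s (t + t') s₂
  | branchTrue {b : Test} {P Q : Prog} {s s' : State} {t : ℕ} (hb : b.Holds s)
      (h : Exec P s t s') : Exec (.branch b P Q) s (t + 1) s'
  | branchFalse {b : Test} {P Q : Prog} {s s' : State} {t : ℕ} (hb : ¬ b.Holds s)
      (h : Exec Q s t s') : Exec (.branch b P Q) s (t + 1) s'
  | loopDone {b : Test} {P : Prog} {s : State} (hb : ¬ b.Holds s) : Exec (.loop b P) s 1 s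
  | loopStep {b : Test} {P : Prog} {s s₁ s₂ : State} {t t' : ℕ} (hb : b.Holds s)
      (hP : Exec P s t s₁) (h : Exec (.loop b P) s₁ t' s₂) :
      Exec (.loop b P) s (t + t' + 1) s₂

/-- A vector stored in an array, from cell `0` on, followed by zeros. -/
def ofVec {n : ℕ} (v : Fin n → ℝ) (j : ℕ) : ℝ := if h : j < n then v ⟨j, h⟩ else 0

/-- The input: register `0` holds `n`, array `0` the values `vA`, array `1` the values `vB`, and
array `2` the four numbers `TA, TB, γ, λ`. Everything else is zero. -/
def input {n : ℕ} (G : BlottoGame n) (g l : ℝ) : State where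
  nat := fun r => if r = 0 then n else 0
  real := fun a =>
    match a with
    | 0 => ofVec G.vA
    | 1 => ofVec G.vB
    | 2 => ofVec ![G.TA, G.TB, g, l]
    | _ => fun _ => 0

/-- The output: array `3` holds the weights `q k`, and array `4` the `n × n` table of the weights
`p k i`, row by row. -/
def IsOutput {n : ℕ} (s : State) (q : Fin n → ℝ) (p : Fin n → Fin n → ℝ) : Prop :=
  (∀ k : Fin n, s.real 3 k = q k) ∧ (∀ k i : Fin n, s.real 4 (k * n + i) = p k i)

end RealRAM

end

/-! ### Couplings with constant sum -/

/-! On battlefield i both Lotto laws mix a mass at 0 with the same uniform law on [0, b i], where b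
i is `lottoLength`, and at least one of the players has no atom there. Against such a law an
allocation in (0, b i] earns an affine function of itself, with a slope that does not depend on i.
So against any coupling of the opponent's marginals no strategy earns more than the Lotto value
(`payoff_le`), and a coupling of the own marginals that always spends the whole budget earns exactly
that value (`payoff_eq`); ties are null, since whoever faces an atom at 0 allocates a positive
amount almost surely. It remains to couple each player's marginals with constant sum.

The weights x of a player lie in the slice of the unit cube on which the sum of b i * p i equals
twice the budget. A vertex of this slice has at most one coordinate in (0, 1), and x is a convex
combination of n vertices (`Stage.iter_decomposition`). They are found as in Carathéodory's theorem:
take a vertex of the smallest face containing the current point, subtract as large a multiple of it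
as possible, and a further coordinate reaches a bound. Mixing couplings made for the vertices gives
back the original marginals.

For a vertex all laws are uniform or Dirac at 0, save perhaps one mixture. They have a coupling with
constant sum T once no interval is longer than T (`HasConstSum.uniform_and_zeroSegMix`); the
mixability condition ensures this for B, and for A because its budget is at least as large. The
uniform laws are first collected into three groups, each driven by a single uniform variable. The
four laws left are reduced to three by merging, gluing or conditioning, and three laws are realised
by mixtures of uniform laws on segments in the plane of sum T.

A round of peeling runs through the coordinates twice, so the n rounds take O(n^2) steps; no sorting
is involved and the logarithm in the bound is not needed. -/

/-- The uniform law on the unit interval. -/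
noncomputable def unitUniform : Measure ℝ := volume.restrict (Set.Icc 0 1)

instance : IsProbabilityMeasure unitUniform := ⟨by simp [unitUniform]⟩

/-- The uniform law on the segment with endpoints `a` and `b` (a Dirac mass if `a = b`). -/
noncomputable def segUniform (a b : ℝ) : Measure ℝ := unitUniform.map fun t => a + (b - a) * t

instance (a b : ℝ) : IsProbabilityMeasure (segUniform a b) :=
  Measure.isProbabilityMeasure_map (by fun_prop)

/-- The average of `f` over the segment with endpoints `a` and `b`. -/
noncomputable def segAvg (f : ℝ → ℝ) (a b : ℝ) : ℝ := ∫ x, f x ∂segUniform a b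

theorem segUniform_self (a : ℝ) : segUniform a a = Measure.dirac a := by
  simp [segUniform]

theorem segAvg_self (f : ℝ → ℝ) (a : ℝ) : segAvg f a a = f a := by
  simp [segAvg, segUniform_self]

/-- Substitution along the segment, valid for either orientation and for a = b. It turns an identity
between mixtures of segment laws, tested on `f`, into algebra with a primitive of `f`. -/
theorem sub_mul_segAvg (f : BoundedContinuousFunction ℝ ℝ) (a b : ℝ) :
    (b - a) * segAvg f a b = (∫ x in (0 : ℝ)..b, f x) - ∫ x in (0 : ℝ)..a, f x := by
  have h1 : segAvg f a b = ∫ t in (0 : ℝ)..1, f (a + (b - a) * t) := by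
    rw [segAvg, segUniform, integral_map (by fun_prop)
      (f.continuous.aestronglyMeasurable), unitUniform, integral_Icc_eq_integral_Ioc,
      intervalIntegral.integral_of_le zero_le_one]
  have hi : ∀ x y : ℝ, IntervalIntegrable f volume x y :=
    fun x y => f.continuous.intervalIntegrable x y
  have h2 := intervalIntegral.smul_integral_comp_add_mul (a := 0) (b := 1) f (b - a) a
  rw [h1, ← smul_eq_mul, h2, intervalIntegral.integral_interval_sub_left (hi _ _) (hi _ _)]
  simp

theorem segUniform_eq_cond {b : ℝ} (hb : 0 < b) :
    segUniform 0 b = ProbabilityTheory.cond volume (Set.Icc 0 b) := by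
  have hp : IsProbabilityMeasure (ProbabilityTheory.cond (volume : Measure ℝ) (Set.Icc 0 b)) :=
    cond_isProbabilityMeasure_of_finite (by simp [hb]) (by simp)
  refine ext_of_forall_integral_eq_of_IsFiniteMeasure fun f => ?_
  have h := sub_mul_segAvg f 0 b
  rw [ProbabilityTheory.cond, integral_smul_measure, integral_Icc_eq_integral_Ioc,
    ← intervalIntegral.integral_of_le hb.le]
  simp only [sub_zero, intervalIntegral.integral_same] at h
  rw [← h, Real.volume_Icc, sub_zero, ENNReal.toReal_inv, ENNReal.toReal_ofReal hb.le,
    smul_eq_mul, segAvg]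
  field_simp

theorem segUniform_zero_map_mul (r c : ℝ) :
    (segUniform 0 c).map (fun x => r * x) = segUniform 0 (r * c) := by
  rw [segUniform, Measure.map_map (by fun_prop) (by fun_prop), segUniform]
  congr 1
  ext t
  simp [mul_assoc]

theorem segUniform_map_add (d a b : ℝ) :
    (segUniform a b).map (fun x => d + x) = segUniform (d + a) (d + b) := by
  rw [segUniform, Measure.map_map (by fun_prop) (by fun_prop), segUniform]
  congr 1
  ext t
  simp only [Function.comp_apply]
  ring

/-- The mixture `(1 - p) δ₀ + p Unif[0, b]`, with `Unif[0, 0] = δ₀`. -/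
noncomputable def zeroSegMix (p b : ℝ) : Measure ℝ :=
  ENNReal.ofReal (1 - p) • Measure.dirac 0 + ENNReal.ofReal p • segUniform 0 b

theorem isProbabilityMeasure_mix {α : Type*} [MeasurableSpace α] (μ ν : Measure α)
    [IsProbabilityMeasure μ] [IsProbabilityMeasure ν] {p : ℝ} (h0 : 0 ≤ p) (h1 : p ≤ 1) :
    IsProbabilityMeasure (ENNReal.ofReal (1 - p) • μ + ENNReal.ofReal p • ν) := by
  constructor
  simp only [Measure.coe_add, Measure.coe_smul, Pi.add_apply, Pi.smul_apply, measure_univ,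
    smul_eq_mul, mul_one]
  rw [← ENNReal.ofReal_add (by linarith) h0]
  simp

theorem zeroSegMix_isProb {p b : ℝ} (h0 : 0 ≤ p) (h1 : p ≤ 1) :
    IsProbabilityMeasure (zeroSegMix p b) := isProbabilityMeasure_mix _ _ h0 h1

theorem integral_mix {α : Type*} [MeasurableSpace α] (μ ν : Measure α) {p : ℝ} (h0 : 0 ≤ p)
    (h1 : p ≤ 1) {f : α → ℝ} (hμ : Integrable f μ) (hν : Integrable f ν) :
    ∫ x, f x ∂(ENNReal.ofReal (1 - p) • μ + ENNReal.ofReal p • ν) =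
      (1 - p) * ∫ x, f x ∂μ + p * ∫ x, f x ∂ν := by
  rw [integral_add_measure (hμ.smul_measure (by simp)) (hν.smul_measure (by simp)),
    integral_smul_measure, integral_smul_measure, ENNReal.toReal_ofReal (by linarith),
    ENNReal.toReal_ofReal h0, smul_eq_mul, smul_eq_mul]

theorem integral_zeroSegMix {p b : ℝ} (h0 : 0 ≤ p) (h1 : p ≤ 1)
    (f : BoundedContinuousFunction ℝ ℝ) :
    ∫ x, f x ∂zeroSegMix p b = (1 - p) * f 0 + p * segAvg f 0 b := by
  rw [zeroSegMix, integral_mix _ _ h0 h1 (f.integrable _) (f.integrable _), integral_dirac]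
  rfl

theorem zeroSegMix_one (b : ℝ) : zeroSegMix 1 b = segUniform 0 b := by simp [zeroSegMix]

theorem zeroSegMix_zero (b : ℝ) : zeroSegMix 0 b = Measure.dirac 0 := by simp [zeroSegMix]

theorem zeroSegMix_eq_zeroUnifMix (p : ℝ) {b : ℝ} (hb : 0 < b) :
    zeroSegMix p b = zeroUnifMix p b := by
  rw [zeroSegMix, segUniform_eq_cond hb, zeroUnifMix]

/-! ### Finite mixtures -/

section Mixture

variable {κ α : Type*} [Fintype κ] [MeasurableSpace α]

theorem mixture_isProb {w : κ → ℝ} (hw : ∀ k, 0 ≤ w k) (hs : ∑ k, w k = 1)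
    {μ : κ → Measure α} (hμ : ∀ k, IsProbabilityMeasure (μ k)) :
    IsProbabilityMeasure (∑ k, ENNReal.ofReal (w k) • μ k) := by
  constructor
  simp only [Measure.coe_finsetSum, Measure.coe_smul, Finset.sum_apply, Pi.smul_apply,
    measure_univ, smul_eq_mul, mul_one]
  rw [← ENNReal.ofReal_sum_of_nonneg fun k _ => hw k, hs]
  simp

theorem mixture_map {β : Type*} [MeasurableSpace β] (w : κ → ℝ) (μ : κ → Measure α)
    {f : α → β} (hf : Measurable f) :
    (∑ k, ENNReal.ofReal (w k) • μ k).map f = ∑ k, ENNReal.ofReal (w k) • (μ k).map f := by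
  rw [Measure.map_finset_sum hf.aemeasurable]
  simp [Measure.map_smul]

theorem mixture_ae {w : κ → ℝ} {μ : κ → Measure α} {P : α → Prop}
    (h : ∀ k, ∀ᵐ x ∂μ k, P x) : ∀ᵐ x ∂(∑ k, ENNReal.ofReal (w k) • μ k), P x := by
  rw [ae_iff, Measure.coe_finsetSum, Finset.sum_apply]
  refine Finset.sum_eq_zero fun k _ => ?_
  simp [ae_iff.1 (h k)]

theorem mixture_integral {w : κ → ℝ} (hw : ∀ k, 0 ≤ w k) {μ : κ → Measure α} {f : α → ℝ}
    (hf : ∀ k, Integrable f (μ k)) :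
    ∫ x, f x ∂(∑ k, ENNReal.ofReal (w k) • μ k) = ∑ k, w k * ∫ x, f x ∂μ k := by
  rw [integral_finsetSum_measure fun k _ => (hf k).smul_measure (by simp)]
  exact Finset.sum_congr rfl fun k _ => by
    rw [integral_smul_measure, ENNReal.toReal_ofReal (hw k), smul_eq_mul]

end Mixture

/-- The laws `μ i` have a coupling with constant sum `T`. -/
def HasConstSum {ι : Type*} [Fintype ι] (μ : ι → Measure ℝ) (T : ℝ) : Prop :=
  ∃ ρ : Measure (ι → ℝ), IsProbabilityMeasure ρ ∧ (∀ i, ρ.map (fun x => x i) = μ i) ∧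
    ∀ᵐ x ∂ρ, ∑ i, x i = T

namespace HasConstSum

variable {ι κ : Type*} [Fintype ι] [Fintype κ] {T : ℝ}

/-- A point moves at constant speed from `a` to `b`, inside the hyperplane of sum T because both
ends lie in it. All further couplings are assembled from these. -/
theorem segment (a b : ι → ℝ) (ha : ∑ i, a i = T) (hb : ∑ i, b i = T) :
    HasConstSum (fun i => segUniform (a i) (b i)) T := by
  refine ⟨unitUniform.map fun t i => a i + (b i - a i) * t,
    Measure.isProbabilityMeasure_map (by fun_prop), fun i => ?_, ?_⟩
  · rw [Measure.map_map (by fun_prop) (by fun_prop)]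
    rfl
  · rw [ae_map_iff (by fun_prop) (measurableSet_eq_fun (by fun_prop) (by fun_prop))]
    refine ae_of_all _ fun t => ?_
    rw [Finset.sum_add_distrib, ← Finset.sum_mul, Finset.sum_sub_distrib, ha, hb]
    ring

/-- A mixture of laws with couplings of sum `T`, in terms of test functions. -/
theorem mixture {w : κ → ℝ} (hw : ∀ k, 0 ≤ w k) (hs : ∑ k, w k = 1)
    {μ : κ → ι → Measure ℝ} (hμ : ∀ k, HasConstSum (μ k) T) {ν : ι → Measure ℝ}
    (hν : ∀ i, IsProbabilityMeasure (ν i))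
    (h : ∀ i (f : BoundedContinuousFunction ℝ ℝ),
      ∫ x, f x ∂ν i = ∑ k, w k * ∫ x, f x ∂μ k i) : HasConstSum ν T := by
  choose ρ hρ hm hsum using hμ
  refine ⟨∑ k, ENNReal.ofReal (w k) • ρ k, mixture_isProb hw hs hρ, fun i => ?_,
    mixture_ae hsum⟩
  rw [mixture_map w ρ (by fun_prop)]
  simp only [hm]
  have hp : ∀ k, IsProbabilityMeasure (μ k i) := fun k => by
    rw [← hm k i]
    exact Measure.isProbabilityMeasure_map (measurable_pi_apply i).aemeasurable
  have := mixture_isProb hw hs hp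
  refine ext_of_forall_integral_eq_of_IsFiniteMeasure fun f => ?_
  rw [mixture_integral hw fun k => f.integrable _, h]

/-- Distributing each coordinate over a group of coordinates in fixed proportions. -/
theorem distribute [DecidableEq κ] {μ : κ → Measure ℝ} (h : HasConstSum μ T) (g : ι → κ)
    (r : ι → ℝ) (hr : ∀ k, ∑ i with g i = k, r i = 1 ∨ μ k = Measure.dirac 0) :
    HasConstSum (fun i => (μ (g i)).map fun x => r i * x) T := by
  obtain ⟨ρ, hρ, hm, hsum⟩ := h
  -- The second alternative in `hr` covers empty groups and groups of total length zero, whose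
  -- proportions cannot sum to 1 but whose coordinate vanishes.
  have hk : ∀ k, ∀ᵐ x ∂ρ, (∑ i with g i = k, r i) * x k = x k := fun k => by
    rcases hr k with h | h
    · simp [h]
    · have : ∀ᵐ y ∂(ρ.map fun x => x k), y = 0 := by
        rw [hm, h, ae_dirac_eq]
        simp
      filter_upwards [ae_of_ae_map (measurable_pi_apply k).aemeasurable this] with x hx
      simp [hx]
  have hmeas : Measurable fun (x : κ → ℝ) i => r i * x (g i) := by fun_prop
  refine ⟨ρ.map fun x i => r i * x (g i), Measure.isProbabilityMeasure_map hmeas.aemeasurable,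
    fun i => ?_, ?_⟩
  · beta_reduce
    rw [Measure.map_map (by fun_prop) (by fun_prop), ← hm, Measure.map_map (by fun_prop)
      (by fun_prop)]
    rfl
  · rw [ae_map_iff hmeas.aemeasurable (measurableSet_eq_fun (by fun_prop) (by fun_prop))]
    filter_upwards [hsum, ae_all_iff.2 hk] with x hx hkx
    rw [← hx, ← Finset.sum_fiberwise_of_maps_to (g := g) (t := Finset.univ)
      (fun i _ => Finset.mem_univ _)]
    refine Finset.sum_congr rfl fun k _ => ?_
    rw [← hkx k, Finset.sum_mul]
    refine Finset.sum_congr rfl fun i hi => ?_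
    rw [(Finset.mem_filter.1 hi).2]

theorem reindex {μ : κ → Measure ℝ} (h : HasConstSum μ T) (e : ι ≃ κ) :
    HasConstSum (fun i => μ (e i)) T := by
  classical
  have := h.distribute e (fun _ => 1) fun k => Or.inl (by
    rw [Finset.sum_const, nsmul_eq_mul, mul_one, Nat.cast_eq_one, Finset.card_eq_one]
    exact ⟨e.symm k, by ext i; simp [Equiv.eq_symm_apply]⟩)
  simpa using this

theorem translate {μ : ι → Measure ℝ} (h : HasConstSum μ T) (d : ι → ℝ) :
    HasConstSum (fun i => (μ i).map fun x => d i + x) (∑ i, d i + T) := by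
  obtain ⟨ρ, hρ, hm, hsum⟩ := h
  have hmeas : Measurable fun (x : ι → ℝ) i => d i + x i := by fun_prop
  refine ⟨ρ.map fun x i => d i + x i, Measure.isProbabilityMeasure_map hmeas.aemeasurable,
    fun i => ?_, ?_⟩
  · beta_reduce
    rw [Measure.map_map (by fun_prop) (by fun_prop), ← hm, Measure.map_map (by fun_prop)
      (by fun_prop)]
    rfl
  · rw [ae_map_iff hmeas.aemeasurable (measurableSet_eq_fun (by fun_prop) (by fun_prop))]
    filter_upwards [hsum] with x hx
    rw [Finset.sum_add_distrib, hx]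

end HasConstSum

/-! ### Three laws -/

theorem segAvg_swap (f : BoundedContinuousFunction ℝ ℝ) (a b : ℝ) :
    segAvg f a b = segAvg f b a := by
  rcases eq_or_ne a b with rfl | h
  · rfl
  · have h1 := sub_mul_segAvg f a b
    have h2 := sub_mul_segAvg f b a
    have h3 : b - a ≠ 0 := sub_ne_zero.2 h.symm
    apply mul_left_cancel₀ h3
    linarith

theorem segUniform_swap (a b : ℝ) : segUniform a b = segUniform b a :=
  ext_of_forall_integral_eq_of_IsFiniteMeasure fun f => segAvg_swap f a b

/-- The mixture `(1 - e) Unif[0, a] + e Unif[0, b]`. -/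
noncomputable def segMix (e a b : ℝ) : Measure ℝ :=
  ENNReal.ofReal (1 - e) • segUniform 0 a + ENNReal.ofReal e • segUniform 0 b

theorem integral_segMix {e a b : ℝ} (h0 : 0 ≤ e) (h1 : e ≤ 1)
    (f : BoundedContinuousFunction ℝ ℝ) :
    ∫ x, f x ∂segMix e a b = (1 - e) * segAvg f 0 a + e * segAvg f 0 b :=
  integral_mix _ _ h0 h1 (f.integrable _) (f.integrable _)

namespace HasConstSum

theorem mixture_three {ι : Type*} [Fintype ι] {T w₀ w₁ w₂ : ℝ} (h₀ : 0 ≤ w₀) (h₁ : 0 ≤ w₁)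
    (h₂ : 0 ≤ w₂) (hs : w₀ + w₁ + w₂ = 1) {μ₀ μ₁ μ₂ ν : ι → Measure ℝ}
    (H₀ : HasConstSum μ₀ T) (H₁ : HasConstSum μ₁ T) (H₂ : HasConstSum μ₂ T)
    (hν : ∀ i, IsProbabilityMeasure (ν i))
    (h : ∀ i (f : BoundedContinuousFunction ℝ ℝ), ∫ x, f x ∂ν i =
      w₀ * ∫ x, f x ∂μ₀ i + w₁ * ∫ x, f x ∂μ₁ i + w₂ * ∫ x, f x ∂μ₂ i) : HasConstSum ν T := by
  refine mixture (w := ![w₀, w₁, w₂]) (fun k => ?_) (by simpa [Fin.sum_univ_three] using hs)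
    (μ := ![μ₀, μ₁, μ₂]) (fun k => ?_) hν (fun i f => ?_)
  · fin_cases k <;> assumption
  · fin_cases k <;> assumption
  · simpa [Fin.sum_univ_three] using h i f

/-- The coupling lives on the three sides of the triangle with corners (T - b, 0, b), (u, T - u, 0)
and (0, v, T - v), all in the plane of sum T. The weights of the sides are those for which the first
and the third coordinate are uniform: the sides projecting to [0, T - b] and [T - b, u] have weights
proportional to these lengths, and likewise [0, T - v] and [T - v, b] in the third coordinate. The
second coordinate then has the stated mixture as its law. -/
theorem two_uniform_and_mix {T u v b : ℝ} (hu0 : 0 < u) (hv0 : 0 < v) (hb0 : 0 < b)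
    (hu : u ≤ T) (hv : v ≤ T) (hb : b ≤ T) (hs : 2 * T ≤ u + v + b) :
    HasConstSum ![segUniform 0 u, segMix ((T - b) / (u + v - T)) (T - u) v, segUniform 0 b]
      T := by
  have hL : 0 ≤ u + v - T := by linarith
  have he0 : 0 ≤ (T - b) / (u + v - T) := div_nonneg (by linarith) hL
  have he1 : (T - b) / (u + v - T) ≤ 1 := div_le_one_of_le₀ (by linarith) hL
  have hN1 : 0 ≤ (v + b - T) * u := mul_nonneg (by linarith) hu0.le
  have hN2 : 0 ≤ (T - b) * (T - v) := mul_nonneg (by linarith) (by linarith)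
  obtain ⟨N, hNdef⟩ : ∃ N, N = (v + b - T) * u + (T - b) * (T - v) := ⟨_, rfl⟩
  have hN : 0 < N := by
    refine lt_of_le_of_ne (by linarith) fun h => ?_
    have h1 : v + b - T = 0 := by
      rcases mul_eq_zero.1 (by linarith : (v + b - T) * u = 0) with h | h
      · exact h
      · exact absurd h hu0.ne'
    rcases mul_eq_zero.1 (by linarith : (T - b) * (T - v) = 0) with h | h <;> linarith
  have hw : ∀ k, 0 ≤ (![(u + b - T) * (v + b - T) / N, (T - b) * (v + b - T) / N,
      (T - b) * (T - v) / N] : Fin 3 → ℝ) k := by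
    have h1 : 0 ≤ u + b - T := by linarith
    have h2 : 0 ≤ v + b - T := by linarith
    have h3 : 0 ≤ T - b := by linarith
    have h4 : 0 ≤ T - v := by linarith
    intro k
    fin_cases k <;> simp <;> positivity
  refine mixture hw (μ := fun k i => segUniform
      ((![![T - b, 0, b], ![0, v, T - v], ![u, T - u, 0]] : Fin 3 → Fin 3 → ℝ) k i)
      ((![![u, T - u, 0], ![T - b, 0, b], ![0, v, T - v]] : Fin 3 → Fin 3 → ℝ) k i)) ?_
    (fun k => segment _ _ ?_ ?_) ?_ ?_
  · simp only [Fin.sum_univ_three, Matrix.cons_val]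
    field_simp
    rw [hNdef]
    ring
  · fin_cases k <;> simp [Fin.sum_univ_three]
  · fin_cases k <;> simp [Fin.sum_univ_three]
  · intro i
    fin_cases i
    · simp; infer_instance
    · exact isProbabilityMeasure_mix _ _ he0 he1
    · simp; infer_instance
  intro i f
  have hT := sub_mul_segAvg f
  fin_cases i
  · simp only [Fin.zero_eta, Fin.isValue, Matrix.cons_val_zero, Fin.sum_univ_three, Matrix.cons_val]
    change segAvg f 0 u = _ * segAvg f _ _ + _ * segAvg f _ _ + _ * segAvg f _ _
    have h1 := hT 0 u
    have h2 := hT (T - b) u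
    have h3 := hT 0 (T - b)
    rw [segAvg_swap f u 0]
    simp only [intervalIntegral.integral_same] at h1 h2 h3
    field_simp
    linear_combination (segAvg f 0 u) * hNdef + (v + b - T) * h1 - (v + b - T) * h2
      - (v + b - T) * h3
  · change ∫ x, f x ∂segMix _ _ _ = _
    simp only [Fin.mk_one, Fin.isValue, Fin.sum_univ_three, Matrix.cons_val]
    change _ = _ * segAvg f _ _ + _ * segAvg f _ _ + _ * segAvg f _ _
    rw [integral_segMix he0 he1]
    have h1 := hT 0 v
    have h2 := hT (T - u) v
    have h3 := hT 0 (T - u)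
    rw [segAvg_swap f v 0]
    simp only [intervalIntegral.integral_same] at h1 h2 h3
    -- If u + v = T then b = T, and the weight (T - b) / (u + v - T) is 0 / 0 = 0.
    rcases hL.eq_or_lt with hL | hL
    · have hbT : b = T := by linarith
      subst hbT
      rw [← hL]
      simp only [sub_self, div_zero, zero_mul, zero_div, add_zero, sub_zero, one_mul]
      rw [hNdef]
      field_simp
      ring
    · field_simp
      linear_combination ((u + v - T - (T - b)) * segAvg f 0 (T - u)
        + (T - b) * segAvg f 0 v) * hNdef - (T - b) * (T - v) * (h2 - h1 + h3)
  · simp only [Fin.reduceFinMk, Fin.isValue, Fin.sum_univ_three, Matrix.cons_val]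
    change segAvg f 0 b = _ * segAvg f _ _ + _ * segAvg f _ _ + _ * segAvg f _ _
    have h1 := hT 0 b
    have h2 := hT (T - v) b
    have h3 := hT 0 (T - v)
    rw [segAvg_swap f b 0]
    simp only [intervalIntegral.integral_same] at h1 h2 h3
    field_simp
    linear_combination (segAvg f 0 b) * hNdef + (T - b) * h1 - (T - b) * h2
      - (T - b) * h3

/-- Here the weight in `two_uniform_and_mix` is 1, unless u + v = T, when both parts of the mixture
are Unif[0, v]. If u or v vanishes, the two other lengths equal T and their coordinates run in
opposite directions. -/
theorem three_uniform {T u v b : ℝ} (hu0 : 0 ≤ u) (hv0 : 0 ≤ v) (hb0 : 0 < b)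
    (hu : u ≤ T) (hv : v ≤ T) (hb : b ≤ T) (hs : u + v + b = 2 * T) :
    HasConstSum ![segUniform 0 u, segUniform 0 v, segUniform 0 b] T := by
  rcases hu0.eq_or_lt with rfl | hu0
  · have h1 : v = T := by linarith
    have h2 : b = T := by linarith
    rw [h1, h2]
    have h := segment (T := T) ![0, 0, T] ![0, T, 0] (by simp [Fin.sum_univ_three])
      (by simp [Fin.sum_univ_three])
    convert h using 1
    ext1 i
    fin_cases i
    · rfl
    · rfl
    · exact segUniform_swap _ _
  rcases hv0.eq_or_lt with rfl | hv0
  · have h1 : u = T := by linarith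
    have h2 : b = T := by linarith
    rw [h1, h2]
    have h := segment (T := T) ![0, 0, T] ![T, 0, 0] (by simp [Fin.sum_univ_three])
      (by simp [Fin.sum_univ_three])
    convert h using 1
    ext1 i
    fin_cases i
    · rfl
    · rfl
    · exact segUniform_swap _ _
  convert two_uniform_and_mix hu0 hv0 hb0 hu hv hb hs.ge using 3
  rcases (by linarith : T ≤ u + v).eq_or_lt with h | h
  · have h1 : v = T - u := by linarith
    have h2 : T - b = 0 := by linarith
    rw [h2, h1]
    simp [segMix]
  · have h1 : (T - b) / (u + v - T) = 1 := by
      rw [div_eq_one_iff_eq (by linarith)]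
      linarith
    simp [segMix, h1]

/-- Two uniform laws and the law `(1 - p) δ₀ + p Unif[0, b]`. -/
theorem two_uniform_and_zeroSegMix {T u v b p : ℝ} (hu0 : 0 ≤ u) (hv0 : 0 ≤ v) (hb0 : 0 < b)
    (hp0 : 0 ≤ p) (hp1 : p ≤ 1) (hu : u ≤ T) (hv : v ≤ T) (hb : b ≤ T)
    (hs : u + v + p * b = 2 * T) :
    HasConstSum ![segUniform 0 u, segUniform 0 v, zeroSegMix p b] T := by
  rcases hp1.eq_or_lt with rfl | hp1'
  · rw [zeroSegMix_one]
    exact three_uniform hu0 hv0 hb0 hu hv hb (by linarith)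
  obtain ⟨L, hLdef⟩ : ∃ L, L = u + v - T := ⟨_, rfl⟩
  have hL : (1 - p) * b ≤ L := by nlinarith
  have hq : 0 < 1 - p := by linarith
  have hL0 : 0 < L := lt_of_lt_of_le (mul_pos hq hb0) hL
  have hpos : ∀ x y : ℝ, 0 ≤ y → y ≤ T → x + y + p * b = 2 * T → 0 < x := by
    intro x y hy hyT h
    by_contra hx
    nlinarith [mul_pos hq hb0]
  have hu0' := hpos u v hv0 hv hs
  have hv0' := hpos v u hu0 hu (by linarith)
  have hsum : 2 * T ≤ u + v + b := by nlinarith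
  have hA := two_uniform_and_mix hu0' hv0' hb0 hu hv hb hsum
  have hB : HasConstSum ![segMix ((T - b) / (v + u - T)) (T - v) u, segUniform 0 v,
      segUniform 0 b] T := by
    convert (two_uniform_and_mix hv0' hu0' hb0 hv hu hb (by linarith)).reindex
      (Equiv.swap (0 : Fin 3) 1) using 1
    ext1 i
    fin_cases i <;> rfl
  have hC : HasConstSum ![segUniform (T - v) u, segUniform (T - u) v, segUniform 0 0] T := by
    convert segment (T := T) ![T - v, v, 0] ![u, T - u, 0] (by simp [Fin.sum_univ_three])
      (by simp [Fin.sum_univ_three]) using 1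
    ext1 i
    fin_cases i
    · rfl
    · exact segUniform_swap _ _
    · rfl
  have he : L - (T - b) = (1 - p) * b := by linarith
  have hqb : 0 < (1 - p) * b := mul_pos hq hb0
  have he0 : 0 ≤ (T - b) / L := div_nonneg (by linarith) hL0.le
  have he1 : (T - b) / L ≤ 1 := div_le_one_of_le₀ (by linarith) hL0.le
  -- The coupling sought is (1 - p) `hC` + y `hA` + z `hB`, where only `hC` has its third coordinate
  -- at 0. The weight z is such that the part on [0, T - v] coming from `hB` completes the Unif[T -
  -- v, u] of `hC` to Unif[0, u]; y does the same for the second coordinate. By `he` the formulas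
  -- amount to y = (T - u) / b and z = (T - v) / b, so y + z = p.
  obtain ⟨y, hy⟩ : ∃ y, y = (L - (1 - p) * u - p * (T - b)) / ((1 - p) * b) := ⟨_, rfl⟩
  obtain ⟨z, hz⟩ : ∃ z, z = (L - (1 - p) * v - p * (T - b)) / ((1 - p) * b) := ⟨_, rfl⟩
  have hy0 : 0 ≤ y := by
    rw [hy]
    refine div_nonneg ?_ hqb.le
    nlinarith [mul_nonneg hq.le (by linarith : 0 ≤ T - u)]
  have hz0 : 0 ≤ z := by
    rw [hz]
    refine div_nonneg ?_ hqb.le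
    nlinarith [mul_nonneg hq.le (by linarith : 0 ≤ T - v)]
  rw [eq_div_iff hqb.ne'] at hy hz
  have hyz : y + z = p := by
    apply mul_right_cancel₀ hqb.ne'
    rw [add_mul, hy, hz, hLdef, (by linarith : T = (u + v + p * b) / 2)]
    ring
  have hLv : v + u - T = L := by linarith
  have he' : (T - b) / L * L = T - b := div_mul_cancel₀ _ hL0.ne'
  rw [← hLdef] at hA
  rw [hLv] at hB
  refine mixture_three hq.le hy0 hz0 (by linarith) hC hA hB (fun i => ?_) (fun i f => ?_)
  · fin_cases i
    · simp; infer_instance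
    · simp; infer_instance
    · exact zeroSegMix_isProb hp0 hp1
  · have h1 := sub_mul_segAvg f
    fin_cases i
    · change segAvg f 0 u = _
      change _ = _ * segAvg f (T - v) u + _ * segAvg f 0 u + _ * ∫ x, f x ∂segMix _ _ _
      rw [integral_segMix he0 he1]
      have h2 := h1 (T - v) u
      have h3 := h1 0 u
      have h4 := h1 0 (T - v)
      simp only [intervalIntegral.integral_same] at h2 h3 h4
      generalize (T - b) / L = e at he'
      obtain rfl : y = p - z := by linarith
      apply mul_left_cancel₀ hL0.ne'
      linear_combination -(1 - p) * (h2 - h3 + h4 + segAvg f (T - v) u * hLdef)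
        + (segAvg f 0 u - segAvg f 0 (T - v)) * (-z * he' + z * he + hz)
        + segAvg f 0 u * ((2 - p) * hLdef + hs) - segAvg f 0 (T - v) * (hLdef + hs)
    · change segAvg f 0 v = _
      change _ = _ * segAvg f (T - u) v + _ * (∫ x, f x ∂segMix _ _ _) + _ * segAvg f 0 v
      rw [integral_segMix he0 he1]
      have h2 := h1 (T - u) v
      have h3 := h1 0 v
      have h4 := h1 0 (T - u)
      simp only [intervalIntegral.integral_same] at h2 h3 h4
      generalize (T - b) / L = e at he'
      obtain rfl : z = p - y := by linarith
      apply mul_left_cancel₀ hL0.ne'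
      linear_combination -(1 - p) * (h2 - h3 + h4 + segAvg f (T - u) v * hLdef)
        + (segAvg f 0 v - segAvg f 0 (T - u)) * (-y * he' + y * he + hy)
        + segAvg f 0 v * ((2 - p) * hLdef + hs) - segAvg f 0 (T - u) * (hLdef + hs)
    · change ∫ x, f x ∂zeroSegMix _ _ = _
      change _ = _ * segAvg f 0 0 + _ * segAvg f 0 b + _ * segAvg f 0 b
      rw [integral_zeroSegMix hp0 hp1, segAvg_self, ← hyz]
      ring

end HasConstSum

/-! ### Gluing couplings, and three uniform laws with one mixture -/

theorem compProd_comap_map {α β γ : Type*} [MeasurableSpace α] [MeasurableSpace β]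
    [MeasurableSpace γ] (μ : Measure α) [SFinite μ] {h : α → β} (hh : Measurable h)
    (κ : Kernel β γ) [IsSFiniteKernel κ] :
    (μ.compProd (κ.comap h hh)).map (Prod.map h id) = (μ.map h).compProd κ := by
  ext s hs
  have hp : Measurable (Prod.map h (id : γ → γ)) := hh.prodMap measurable_id
  rw [Measure.map_apply hp hs, Measure.compProd_apply (hp hs), Measure.compProd_apply hs,
    lintegral_map (Kernel.measurable_kernel_prodMk_left hs) hh]
  rfl

namespace HasConstSum

/-- Gluing two couplings of three laws along a common marginal. -/
theorem glue {μ₀ μ₁ μ₂ μ₃ ω ω' : Measure ℝ} {c T : ℝ} (h₁ : HasConstSum ![μ₁, ω', μ₀] c)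
    (h₂ : HasConstSum ![μ₂, μ₃, ω] T) (hω : ω'.map (fun x => c - x) = ω) :
    HasConstSum ![μ₁, μ₂, μ₃, μ₀] T := by
  obtain ⟨ρ₁, hρ₁, hm₁, hs₁⟩ := h₁
  obtain ⟨ρ₂, hρ₂, hm₂, hs₂⟩ := h₂
  have hg : Measurable fun y : Fin 3 → ℝ => (y 2, y) := by fun_prop
  have hh : Measurable fun x : Fin 3 → ℝ => c - x 1 := by fun_prop
  obtain ⟨σ, hσ⟩ : ∃ σ, σ = ρ₂.map fun y : Fin 3 → ℝ => (y 2, y) := ⟨_, rfl⟩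
  have hσp : IsProbabilityMeasure σ := by
    rw [hσ]; exact Measure.isProbabilityMeasure_map hg.aemeasurable
  have hfst : σ.fst = ρ₁.map fun x => c - x 1 := by
    rw [hσ, Measure.fst, Measure.map_map measurable_fst hg]
    change ρ₂.map (fun y => y 2) = _
    rw [hm₂ 2]
    change ω = _
    rw [← hω]
    change (![μ₁, ω', μ₀] 1).map _ = _
    rw [← hm₁ 1, Measure.map_map (by fun_prop) (by fun_prop)]
    rfl
  -- Draw the first triple x, then the second triple conditionally on its last coordinate being c -
  -- x 1. That coordinate equals x 0 + x 2, so it may be replaced by these two without changing the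
  -- sum T.
  obtain ⟨τ, hτ⟩ : ∃ τ, τ = ρ₁.compProd (σ.condKernel.comap _ hh) := ⟨_, rfl⟩
  have hτp : IsProbabilityMeasure τ := by rw [hτ]; infer_instance
  have hτ1 : τ.map Prod.fst = ρ₁ := by rw [hτ]; exact Measure.fst_compProd _ _
  have hτ2 : τ.map (Prod.map (fun x : Fin 3 → ℝ => c - x 1) id) = σ := by
    rw [hτ, compProd_comap_map, ← hfst, σ.disintegrate]
  have hτ3 : τ.map Prod.snd = ρ₂ := by
    have : σ.map Prod.snd = ρ₂ := by
      rw [hσ, Measure.map_map measurable_snd hg]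
      exact Measure.map_id
    rw [← this, ← hτ2, Measure.map_map measurable_snd (hh.prodMap measurable_id)]
    rfl
  have hτ4 : ∀ᵐ z ∂τ, z.2 2 = c - z.1 1 := by
    have h : ∀ᵐ z ∂σ, z.2 2 = z.1 := by
      rw [hσ, ae_map_iff hg.aemeasurable (measurableSet_eq_fun (by fun_prop) (by fun_prop))]
      exact ae_of_all _ fun _ => rfl
    rw [← hτ2] at h
    exact ae_of_ae_map (hh.prodMap measurable_id).aemeasurable h
  have hs₁' : ∀ᵐ z ∂τ, ∑ i, z.1 i = c := by
    rw [← hτ1] at hs₁; exact ae_of_ae_map measurable_fst.aemeasurable hs₁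
  have hs₂' : ∀ᵐ z ∂τ, ∑ i, z.2 i = T := by
    rw [← hτ3] at hs₂; exact ae_of_ae_map measurable_snd.aemeasurable hs₂
  have hF : Measurable fun (z : (Fin 3 → ℝ) × (Fin 3 → ℝ)) =>
      ![z.1 0, z.2 0, z.2 1, z.1 2] := by
    refine measurable_pi_iff.2 fun i => ?_
    fin_cases i <;> simp <;> fun_prop
  refine ⟨τ.map fun z => ![z.1 0, z.2 0, z.2 1, z.1 2],
    Measure.isProbabilityMeasure_map hF.aemeasurable, fun i => ?_, ?_⟩
  · rw [Measure.map_map (by fun_prop) hF]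
    have e1 : ∀ j, τ.map (fun z => z.1 j) = ![μ₁, ω', μ₀] j := fun j => by
      rw [← hm₁, ← hτ1, Measure.map_map (by fun_prop) (by fun_prop)]; rfl
    have e2 : ∀ j, τ.map (fun z => z.2 j) = ![μ₂, μ₃, ω] j := fun j => by
      rw [← hm₂, ← hτ3, Measure.map_map (by fun_prop) (by fun_prop)]; rfl
    fin_cases i
    · exact e1 0
    · exact e2 0
    · exact e2 1
    · exact e1 2
  · rw [ae_map_iff hF.aemeasurable (measurableSet_eq_fun (by fun_prop) (by fun_prop))]
    filter_upwards [hτ4, hs₁', hs₂'] with z h4 h1 h2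
    simp only [Fin.sum_univ_three, Fin.sum_univ_four, Matrix.cons_val] at h1 h2 ⊢
    linarith

theorem segUniform_map_sub (c : ℝ) :
    (segUniform 0 c).map (fun x => c - x) = segUniform 0 c := by
  conv_rhs => rw [segUniform_swap, segUniform]
  rw [segUniform, Measure.map_map (by fun_prop) (by fun_prop)]
  congr 1
  ext t
  simp only [Function.comp_apply]
  ring

theorem map_one_mul (μ : Measure ℝ) : μ.map (fun x => 1 * x) = μ := by simp

/-- Merging the first two of three uniform laws. -/
theorem three_uniform_and_zeroSegMix_of_add_le {T u₁ u₂ u₃ b p : ℝ} (hu₁0 : 0 ≤ u₁)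
    (hu₂0 : 0 ≤ u₂) (hu₃0 : 0 ≤ u₃) (hb0 : 0 < b) (hp0 : 0 ≤ p) (hp1 : p ≤ 1)
    (hu : u₁ + u₂ ≤ T) (hu₃ : u₃ ≤ T) (hb : b ≤ T) (hs : u₁ + u₂ + u₃ + p * b = 2 * T) :
    HasConstSum ![segUniform 0 u₁, segUniform 0 u₂, segUniform 0 u₃, zeroSegMix p b] T := by
  have h := two_uniform_and_zeroSegMix (add_nonneg hu₁0 hu₂0) hu₃0 hb0 hp0 hp1 hu hu₃ hb hs
  have h' := h.distribute (![0, 0, 1, 2] : Fin 4 → Fin 3)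
    ![u₁ / (u₁ + u₂), u₂ / (u₁ + u₂), 1, 1] (fun k => by
      fin_cases k
      · rcases eq_or_ne (u₁ + u₂) 0 with h0 | h0
        · right
          simp [h0, segUniform_self]
        · left
          simp [Finset.sum_filter, Fin.sum_univ_four]
          field_simp
      · left
        simp [Finset.sum_filter, Fin.sum_univ_four]
      · left
        simp [Finset.sum_filter, Fin.sum_univ_four])
  convert h' using 1
  have key : ∀ x, 0 ≤ x → x ≤ u₁ + u₂ → x / (u₁ + u₂) * (u₁ + u₂) = x := fun x h0 h1 => by
    rcases eq_or_ne (u₁ + u₂) 0 with h | h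
    · rw [h] at h1 ⊢
      simp
      linarith
    · exact div_mul_cancel₀ _ h
  ext1 i
  fin_cases i
  · change _ = (segUniform 0 (u₁ + u₂)).map fun x => u₁ / (u₁ + u₂) * x
    rw [segUniform_zero_map_mul, key _ hu₁0 (by linarith)]; rfl
  · change _ = (segUniform 0 (u₁ + u₂)).map fun x => u₂ / (u₁ + u₂) * x
    rw [segUniform_zero_map_mul, key _ hu₂0 (by linarith)]; rfl
  · exact (map_one_mul _).symm
  · exact (map_one_mul _).symm

/-- Two lengths with sum at most T merge into one uniform law. When every pair exceeds T, the
complementary length plus p * b stays below T, and this room is used in two ways according to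
whether b ≤ u₁. -/
theorem three_uniform_and_zeroSegMix {T u₁ u₂ u₃ b p : ℝ} (hu₁0 : 0 ≤ u₁)
    (hu₂0 : 0 ≤ u₂) (hu₃0 : 0 ≤ u₃) (hb0 : 0 < b) (hp0 : 0 ≤ p) (hp1 : p ≤ 1)
    (hu₁ : u₁ ≤ T) (hu₂ : u₂ ≤ T) (hu₃ : u₃ ≤ T) (hb : b ≤ T)
    (hs : u₁ + u₂ + u₃ + p * b = 2 * T) :
    HasConstSum ![segUniform 0 u₁, segUniform 0 u₂, segUniform 0 u₃, zeroSegMix p b] T := by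
  rcases le_or_gt (u₁ + u₂) T with h12 | h12
  · exact three_uniform_and_zeroSegMix_of_add_le hu₁0 hu₂0 hu₃0 hb0 hp0 hp1 h12 hu₃ hb hs
  rcases le_or_gt (u₁ + u₃) T with h13 | h13
  · convert (three_uniform_and_zeroSegMix_of_add_le hu₁0 hu₃0 hu₂0 hb0 hp0 hp1 h13 hu₂ hb
      (by linarith)).reindex (Equiv.swap (1 : Fin 4) 2) using 1
    ext1 i
    fin_cases i <;> rfl
  rcases le_or_gt (u₂ + u₃) T with h23 | h23
  · convert (three_uniform_and_zeroSegMix_of_add_le hu₃0 hu₂0 hu₁0 hb0 hp0 hp1 (by linarith) hu₁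
      hb (by linarith)).reindex (Equiv.swap (0 : Fin 4) 2) using 1
    ext1 i
    fin_cases i <;> rfl
  have hpb : 0 ≤ p * b := mul_nonneg hp0 hb0.le
  -- If b ≤ u₁, Unif[0, u₁] and the mixture can be coupled so that their sum is uniform on [0, u₁ +
  -- p * b]: couple them with a third law of that length to the constant sum u₁ + p * b. The sum
  -- then acts as one of three uniform laws.
  rcases le_or_gt b u₁ with hbu | hbu
  · have hpu : p * b ≤ b := by nlinarith
    have h1 := two_uniform_and_zeroSegMix (T := u₁ + p * b) (u := u₁) (v := u₁ + p * b) hu₁0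
      (by linarith) hb0 hp0 hp1 (by linarith) le_rfl (by linarith) (by ring)
    have h2 := three_uniform (T := T) hu₂0 hu₃0 (b := u₁ + p * b) (by linarith) hu₂ hu₃
      (by linarith) (by linarith)
    exact h1.glue h2 (segUniform_map_sub _)
  -- If u₁ < b, Unif[0, u₁] is split at p * b. On [p * b, u₁] the fourth coordinate is 0 and, after
  -- a shift, three uniform laws with sum T - p * b remain. On [0, p * b], which has probability p *
  -- b / u₁, the fourth law takes the weight u₁ / b, so that p is restored on average, and merging
  -- applies because p * b + u₂ ≤ T.
  · have hu₁pos : 0 < u₁ := by linarith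
    have hpb' : p * b ≤ u₁ := by linarith
    have hr0 : 0 ≤ p * b / u₁ := by positivity
    have hr1 : p * b / u₁ ≤ 1 := div_le_one_of_le₀ hpb' hu₁0
    have h1 := three_uniform_and_zeroSegMix_of_add_le (T := T) (u₁ := p * b) (u₂ := u₂)
      (u₃ := u₃) (p := u₁ / b) hpb hu₂0 hu₃0 hb0 (by positivity)
      (div_le_one_of_le₀ hbu.le hb0.le) (by linarith) hu₃ hb
      (by rw [div_mul_cancel₀ _ hb0.ne']; linarith)
    have h2 := (three_uniform (T := T - p * b) (u := u₁ - p * b) (v := u₂) (b := u₃)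
      (by linarith) hu₂0 (by linarith) (by linarith) (by linarith) (by linarith) (by linarith))
    have h3 : HasConstSum ![segUniform (p * b) u₁, segUniform 0 u₂, segUniform 0 u₃,
        Measure.dirac 0] T := by
      have h := (h2.distribute (![0, 1, 2, 0] : Fin 4 → Fin 3) ![1, 1, 1, 0] (fun k => by
        left
        fin_cases k <;> simp [Finset.sum_filter, Fin.sum_univ_four])).translate
          ![p * b, 0, 0, 0]
      convert h using 1
      · ext1 i
        fin_cases i
        · change _ = Measure.map (fun x => p * b + x)
            ((segUniform 0 (u₁ - p * b)).map fun x => 1 * x)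
          rw [map_one_mul, segUniform_map_add, add_zero, add_sub_cancel]; rfl
        · change _ = Measure.map (fun x => 0 + x) ((segUniform 0 u₂).map fun x => 1 * x)
          simp
        · change _ = Measure.map (fun x => 0 + x) ((segUniform 0 u₃).map fun x => 1 * x)
          simp
        · change _ = Measure.map (fun x => 0 + x)
            ((segUniform 0 (u₁ - p * b)).map fun x => 0 * x)
          simp
      · simp [Fin.sum_univ_four]
    have hq0 : 0 ≤ u₁ / b := by positivity
    have hq1 : u₁ / b ≤ 1 := div_le_one_of_le₀ hbu.le hb0.le
    refine mixture_three (w₀ := 1 - p * b / u₁) (w₁ := p * b / u₁) (w₂ := 0) (by linarith) hr0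
      le_rfl (by ring) h3 h1 h1 (fun i => ?_) (fun i f => ?_)
    · fin_cases i
      · simp; infer_instance
      · simp; infer_instance
      · simp; infer_instance
      · exact zeroSegMix_isProb hp0 hp1
    · have hT := sub_mul_segAvg f
      rw [zero_mul, add_zero]
      fin_cases i
      · change segAvg f 0 u₁ = _ * segAvg f (p * b) u₁ + _ * segAvg f 0 (p * b)
        have e1 := hT (p * b) u₁
        have e2 := hT 0 u₁
        have e3 := hT 0 (p * b)
        simp only [intervalIntegral.integral_same] at e1 e2 e3
        field_simp
        linear_combination e2 - e1 - e3
      · change segAvg f 0 u₂ = _ * segAvg f 0 u₂ + _ * segAvg f 0 u₂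
        ring
      · change segAvg f 0 u₃ = _ * segAvg f 0 u₃ + _ * segAvg f 0 u₃
        ring
      · change ∫ x, f x ∂zeroSegMix _ _ = _ * ∫ x, f x ∂Measure.dirac 0
          + _ * ∫ x, f x ∂zeroSegMix _ _
        rw [integral_zeroSegMix hp0 hp1, integral_zeroSegMix hq0 hq1, integral_dirac]
        field_simp
        ring

/-! ### Any number of uniform laws with one mixture -/

/-- Numbers at most `T` with sum at most `2 T` fall into three groups with sums at most `T`. -/
theorem exists_three_groups {ι : Type*} [DecidableEq ι] (S : Finset ι) (u : ι → ℝ) {T : ℝ}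
    (hT : 0 ≤ T) (hu : ∀ i ∈ S, u i ≤ T) (hs : ∑ i ∈ S, u i ≤ 2 * T) :
    ∃ g : ι → Fin 3, ∀ k, ∑ i ∈ S with g i = k, u i ≤ T := by
  -- `A` is a group of maximal size among those with sum at most T. If some j is left over, `A` with
  -- j exceeds T, so the elements outside sum to less than T and the groups are `A`, {j} and the
  -- rest.
  obtain ⟨A, hA, hmax⟩ := (S.powerset.filter fun A => ∑ i ∈ A, u i ≤ T).exists_max_image
    Finset.card ⟨∅, by simp [hT]⟩
  simp only [Finset.mem_filter, Finset.mem_powerset] at hA hmax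
  by_cases hAS : A = S
  · refine ⟨fun _ => 0, fun k => ?_⟩
    by_cases hk : (0 : Fin 3) = k
    · simp [hk, ← hAS, hA.2]
    · simp [hk, hT]
  obtain ⟨j, hjS, hjA⟩ : ∃ j ∈ S, j ∉ A := by
    by_contra! h
    exact hAS (Finset.Subset.antisymm hA.1 h)
  have hj : T < ∑ i ∈ insert j A, u i := by
    by_contra! h
    have := hmax (insert j A) ⟨Finset.insert_subset hjS hA.1, h⟩
    rw [Finset.card_insert_of_notMem hjA] at this
    omega
  refine ⟨fun i => if i ∈ A then 0 else if i = j then 1 else 2, fun k => ?_⟩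
  fin_cases k
  · have : S.filter (fun i =>
        (if i ∈ A then (0 : Fin 3) else if i = j then 1 else 2) = 0) = A := by
      ext i
      simp only [Finset.mem_filter]
      refine ⟨fun h => ?_, fun h => ⟨hA.1 h, by simp [h]⟩⟩
      by_contra hi
      by_cases hij : i = j <;> simp [hi, hij, hjA] at h
    exact (Finset.sum_congr this fun _ _ => rfl).trans_le hA.2
  · have : S.filter (fun i =>
        (if i ∈ A then (0 : Fin 3) else if i = j then 1 else 2) = 1) = {j} := by
      ext i
      simp only [Finset.mem_filter, Finset.mem_singleton]
      refine ⟨fun h => ?_, fun h => ⟨h ▸ hjS, by simp [h, hjA]⟩⟩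
      by_contra hij
      by_cases hi : i ∈ A <;> simp [hi, hij] at h
    simp [this, hu j hjS]
  · have : S.filter (fun i =>
        (if i ∈ A then (0 : Fin 3) else if i = j then 1 else 2) = 2) =
        S \ insert j A := by
      ext i
      simp only [Finset.mem_filter, Finset.mem_sdiff, Finset.mem_insert, not_or]
      by_cases hi : i ∈ A <;> by_cases hij : i = j <;> simp [hi, hij, hjA]
    have h2 := Finset.sum_sdiff (f := u) (Finset.insert_subset hjS hA.1)
    simp only [Fin.reduceFinMk, this]
    linarith

/-- Uniform laws on intervals `[0, u i]` and one law `(1 - p) δ₀ + p Unif[0, b]` have a coupling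
with constant sum as soon as no interval is longer than the sum of the expectations. -/
theorem uniform_and_zeroSegMix {ι : Type*} [Fintype ι] [DecidableEq ι] (i₀ : ι) (u : ι → ℝ)
    {T b p : ℝ} (hu0 : ∀ i, i ≠ i₀ → 0 ≤ u i) (hu : ∀ i, i ≠ i₀ → u i ≤ T) (hb0 : 0 < b)
    (hb : b ≤ T) (hp0 : 0 ≤ p) (hp1 : p ≤ 1)
    (hs : ∑ i ∈ Finset.univ.erase i₀, u i + p * b = 2 * T) :
    HasConstSum (fun i => if i = i₀ then zeroSegMix p b else segUniform 0 (u i)) T := by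
  have hpb : 0 ≤ p * b := mul_nonneg hp0 hb0.le
  obtain ⟨g, hg⟩ := exists_three_groups (Finset.univ.erase i₀) u (T := T) (by linarith)
    (fun i hi => hu i (Finset.ne_of_mem_erase hi)) (by linarith)
  obtain ⟨U, hU⟩ : ∃ U : Fin 3 → ℝ,
    U = fun k => ∑ i ∈ Finset.univ.erase i₀ with g i = k, u i := ⟨_, rfl⟩
  have hU0 : ∀ k, 0 ≤ U k := fun k => by
    rw [hU]
    exact Finset.sum_nonneg fun i hi =>
      hu0 i (Finset.ne_of_mem_erase (Finset.mem_filter.1 hi).1)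
  have hUT : ∀ k, U k ≤ T := fun k => by rw [hU]; exact hg k
  have hUs : U 0 + U 1 + U 2 + p * b = 2 * T := by
    rw [← hs, ← Finset.sum_fiberwise_of_maps_to (g := g) (t := Finset.univ)
      (fun i _ => Finset.mem_univ _), Fin.sum_univ_three, hU]
  have h := three_uniform_and_zeroSegMix (hU0 0) (hU0 1) (hU0 2) hb0 hp0 hp1 (hUT 0) (hUT 1)
    (hUT 2) hb hUs
  -- Within a group all coordinates are multiples of one uniform variable, in the proportions u i /
  -- U (g i).
  have h' := h.distribute (fun i => if i = i₀ then Fin.last 3 else (g i).castSucc)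
    (fun i => if i = i₀ then 1 else u i / U (g i)) (fun k => by
      induction k using Fin.lastCases with
      | last =>
        left
        have : Finset.univ.filter (fun i => (if i = i₀ then Fin.last 3 else (g i).castSucc) =
            Fin.last 3) = {i₀} := by
          ext i
          by_cases hi : i = i₀
          · simp [hi]
          · simpa [hi] using (Fin.castSucc_lt_last (g i)).ne
        rw [this, Finset.sum_singleton, if_pos rfl]
      | cast k =>
        rcases eq_or_ne (U k) 0 with h0 | h0
        · right
          fin_cases k <;> simp at h0 ⊢ <;> simp [h0, segUniform_self]
        · left
          have : Finset.univ.filter (fun i => (if i = i₀ then Fin.last 3 else (g i).castSucc) =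
              k.castSucc) = (Finset.univ.erase i₀).filter fun i => g i = k := by
            ext i
            by_cases hi : i = i₀
            · simp [hi]
              exact (Fin.castSucc_lt_last k).ne'
            · simp [hi]
          rw [this]
          calc _ = ∑ i ∈ (Finset.univ.erase i₀).filter (fun i => g i = k), u i / U k := by
                refine Finset.sum_congr rfl fun i hi => ?_
                obtain ⟨h1, h2⟩ := Finset.mem_filter.1 hi
                rw [if_neg (Finset.ne_of_mem_erase h1), h2]
            _ = 1 := by
                rw [← Finset.sum_div, div_eq_one_iff_eq h0, hU])
  convert h' using 1
  ext1 i
  by_cases hi : i = i₀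
  · simp only [hi, if_true]
    exact (map_one_mul _).symm
  · simp only [hi, if_false]
    have e : ∀ k : Fin 3, ![segUniform 0 (U 0), segUniform 0 (U 1), segUniform 0 (U 2),
        zeroSegMix p b] k.castSucc = segUniform 0 (U k) := fun k => by fin_cases k <;> rfl
    rw [e, segUniform_zero_map_mul]
    congr 1
    rcases eq_or_ne (U (g i)) 0 with h0 | h0
    · rw [h0, mul_zero]
      rw [hU] at h0
      refine (Finset.sum_eq_zero_iff_of_nonneg fun j hj =>
        hu0 j (Finset.ne_of_mem_erase (Finset.mem_filter.1 hj).1)).1 h0 i ?_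
      simp [hi]
    · rw [div_mul_cancel₀ _ h0]

end HasConstSum

/-! ### Joint mixes with prescribed marginals -/

theorem cond_Icc_isProb {b : ℝ} (hb : 0 < b) :
    IsProbabilityMeasure (ProbabilityTheory.cond (volume : Measure ℝ) (Set.Icc 0 b)) :=
  cond_isProbabilityMeasure_of_finite (by simp [hb]) (by simp)

theorem ae_smul_add_smul {α : Type*} [MeasurableSpace α] {μ ν : Measure α} {c d : ENNReal}
    {P : α → Prop} (hμ : ∀ᵐ x ∂μ, P x) (hν : ∀ᵐ x ∂ν, P x) : ∀ᵐ x ∂(c • μ + d • ν), P x := by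
  rw [ae_iff] at *
  simp [hμ, hν]

theorem ae_cond_Icc (b : ℝ) :
    ∀ᵐ x ∂(ProbabilityTheory.cond (volume : Measure ℝ) (Set.Icc 0 b)), 0 < x ∧ x ≤ b := by
  have h1 := ae_cond_mem (μ := (volume : Measure ℝ)) (measurableSet_Icc (a := 0) (b := b))
  have h2 : ∀ᵐ x ∂(ProbabilityTheory.cond (volume : Measure ℝ) (Set.Icc 0 b)), x ≠ 0 :=
    cond_absolutelyContinuous (Measure.ae_ne volume 0)
  filter_upwards [h1, h2] with x hx hx0
  exact ⟨lt_of_le_of_ne hx.1 hx0.symm, hx.2⟩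

theorem ae_zeroUnifMix {p b : ℝ} (hb : 0 < b) :
    ∀ᵐ x ∂zeroUnifMix p b, 0 ≤ x ∧ x ≤ b := by
  refine ae_smul_add_smul ?_ ?_
  · rw [ae_dirac_eq]
    exact ⟨le_rfl, hb.le⟩
  · filter_upwards [ae_cond_Icc b] with x hx
    exact ⟨hx.1.le, hx.2⟩

theorem ae_zeroUnifMix_one (b : ℝ) : ∀ᵐ x ∂zeroUnifMix 1 b, 0 < x ∧ x ≤ b := by
  simpa [zeroUnifMix] using ae_cond_Icc b

namespace IsCoupling

variable {n : ℕ} {μ : Measure (Fin n → ℝ)} {p b : Fin n → ℝ}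

theorem ae_of_ae {P : Fin n → Measure ℝ} (h : IsCoupling μ P) {i : Fin n} {Q : ℝ → Prop}
    (hQ : ∀ᵐ x ∂P i, Q x) : ∀ᵐ x ∂μ, Q (x i) := by
  rw [← h.marginal i] at hQ
  exact ae_of_ae_map (measurable_pi_apply i).aemeasurable hQ

theorem integrable_apply (h : IsCoupling μ fun i => zeroUnifMix (p i) (b i))
    (hb : ∀ i, 0 < b i) (i : Fin n) : Integrable (fun x => x i) μ := by
  have := h.isProb
  refine Integrable.of_bound (C := b i) (measurable_pi_apply i).aestronglyMeasurable ?_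
  filter_upwards [h.ae_of_ae (i := i) (ae_zeroUnifMix (hb i))] with x hx
  rw [Real.norm_eq_abs, abs_of_nonneg hx.1]
  exact hx.2

theorem isJointMix (h : IsCoupling μ fun i => zeroUnifMix (p i) (b i)) (hb : ∀ i, 0 < b i)
    {T : ℝ} (hs : ∀ᵐ x ∂μ, ∑ i, x i = T) : IsJointMix μ := by
  have := h.isProb
  refine ⟨h.isProb, h.integrable_apply hb, ?_⟩
  have hT : ∑ i, ∫ y, y i ∂μ = T := by
    rw [← integral_finsetSum _ fun i _ => h.integrable_apply hb i, integral_congr_ae hs]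
    simp
  rw [hT]
  exact hs

theorem isBlottoStrategy (h : IsCoupling μ fun i => zeroUnifMix (p i) (b i))
    (hb : ∀ i, 0 < b i) {T : ℝ} (hs : ∀ᵐ x ∂μ, ∑ i, x i = T) : IsBlottoStrategy T μ := by
  refine ⟨h.isProb, ae_all_iff.2 fun i => ?_, hs.mono fun x hx => hx.le⟩
  filter_upwards [h.ae_of_ae (i := i) (ae_zeroUnifMix (hb i))] with x hx using hx.1

end IsCoupling

/-- A vector of weights with at most one entry in `(0, 1)` gives jointly mixable laws. -/
theorem exists_coupling_of_subsingleton {n : ℕ} [NeZero n] {b p : Fin n → ℝ} {T : ℝ}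
    (hb0 : ∀ i, 0 < b i) (hb : ∀ i, b i ≤ T) (hp : ∀ i, 0 ≤ p i ∧ p i ≤ 1)
    (hfrac : {i | 0 < p i ∧ p i < 1}.Subsingleton) (hs : ∑ i, p i * b i = 2 * T) :
    ∃ μ : Measure (Fin n → ℝ), IsCoupling μ (fun i => zeroUnifMix (p i) (b i)) ∧
      ∀ᵐ x ∂μ, ∑ i, x i = T := by
  -- `i₀` is the fractional coordinate, or the arbitrary index 0 if there is none. Every other law
  -- is uniform on [0, p i * b i], which includes the Dirac mass when p i = 0.
  obtain ⟨i₀, hi₀⟩ : ∃ i₀, ∀ i, i ≠ i₀ → p i = 0 ∨ p i = 1 := by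
    by_cases h : ∃ i, 0 < p i ∧ p i < 1
    · obtain ⟨i₀, h₀⟩ := h
      refine ⟨i₀, fun i hi => ?_⟩
      by_contra! h'
      exact hi (hfrac ⟨lt_of_le_of_ne (hp i).1 h'.1.symm, lt_of_le_of_ne (hp i).2 h'.2⟩ h₀)
    · push Not at h
      refine ⟨0, fun i _ => ?_⟩
      rcases (hp i).1.eq_or_lt with h' | h'
      · exact Or.inl h'.symm
      · exact Or.inr (le_antisymm (hp i).2 (h i h'))
  have hle : ∀ i, p i * b i ≤ b i := fun i => by nlinarith [hb0 i, (hp i).2]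
  obtain ⟨μ, h1, h2, h3⟩ := HasConstSum.uniform_and_zeroSegMix i₀ (fun i => p i * b i)
    (fun i _ => mul_nonneg (hp i).1 (hb0 i).le) (fun i _ => (hle i).trans (hb i)) (hb0 i₀)
    (hb i₀) (hp i₀).1 (hp i₀).2 (by rw [Finset.sum_erase_add _ _ (Finset.mem_univ _), hs])
  refine ⟨μ, ⟨h1, fun i => ?_⟩, h3⟩
  rw [h2]
  beta_reduce
  by_cases hi : i = i₀
  · rw [if_pos hi, hi, zeroSegMix_eq_zeroUnifMix _ (hb0 i₀)]
  · rw [if_neg hi, ← zeroSegMix_eq_zeroUnifMix _ (hb0 i)]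
    rcases hi₀ i hi with h | h
    · rw [h, zero_mul, zeroSegMix_zero, segUniform_self]
    · rw [h, one_mul, zeroSegMix_one]

/-! ### Payoffs against Lotto marginals -/

theorem winShare_mem {s x y : ℝ} (hs : 0 ≤ s ∧ s ≤ 1) :
    0 ≤ winShare s x y ∧ winShare s x y ≤ 1 := by
  unfold winShare
  split_ifs <;> simp [hs]

theorem measurable_winShare (s : ℝ) : Measurable fun z : ℝ × ℝ => winShare s z.1 z.2 :=
  Measurable.ite (measurableSet_lt measurable_snd measurable_fst) measurable_const
    (Measurable.ite (measurableSet_eq_fun measurable_fst measurable_snd) measurable_const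
      measurable_const)

theorem integrable_winShare {α : Type*} [MeasurableSpace α] {μ : Measure α} [IsFiniteMeasure μ]
    {s : ℝ} (hs : 0 ≤ s ∧ s ≤ 1) {f g : α → ℝ} (hf : Measurable f) (hg : Measurable g) :
    Integrable (fun x => winShare s (f x) (g x)) μ := by
  refine Integrable.of_bound (C := 1)
    ((measurable_winShare s).comp (hf.prodMk hg)).aestronglyMeasurable (ae_of_all _ fun x => ?_)
  obtain ⟨h0, h1⟩ := winShare_mem (x := f x) (y := g x) hs
  rwa [Real.norm_eq_abs, abs_of_nonneg h0]

theorem integral_winShare_cond {s x b : ℝ} (hb : 0 < b) (hx : 0 ≤ x) :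
    ∫ y, winShare s x y ∂(ProbabilityTheory.cond volume (Set.Icc 0 b)) = min x b / b := by
  have h1 : (fun y => winShare s x y) =ᵐ[ProbabilityTheory.cond volume (Set.Icc 0 b)]
      (Set.Iio x).indicator fun _ => (1 : ℝ) := by
    have h2 : ∀ᵐ y ∂(ProbabilityTheory.cond (volume : Measure ℝ) (Set.Icc 0 b)), y ≠ x :=
      cond_absolutelyContinuous (Measure.ae_ne volume x)
    filter_upwards [h2] with y hy
    simp [winShare, Set.indicator, hy.symm]
  rw [integral_congr_ae h1, integral_indicator measurableSet_Iio, setIntegral_const, smul_eq_mul,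
    mul_one, measureReal_def, cond_apply measurableSet_Icc]
  have h3 : volume (Set.Icc 0 b ∩ Set.Iio x) = ENNReal.ofReal (min x b) := by
    rcases le_or_gt x b with h | h
    · have : Set.Icc 0 b ∩ Set.Iio x = Set.Ico 0 x := by
        ext y
        simp only [Set.mem_inter_iff, Set.mem_Icc, Set.mem_Iio, Set.mem_Ico]
        constructor
        · rintro ⟨⟨h1, h2⟩, h3⟩
          exact ⟨h1, h3⟩
        · rintro ⟨h1, h2⟩
          exact ⟨⟨h1, by linarith⟩, h2⟩
      rw [this, Real.volume_Ico, sub_zero, min_eq_left h]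
    · have : Set.Icc 0 b ∩ Set.Iio x = Set.Icc 0 b := by
        refine Set.inter_eq_left.2 fun y hy => ?_
        exact lt_of_le_of_lt hy.2 h
      rw [this, Real.volume_Icc, sub_zero, min_eq_right h.le]
  rw [h3, Real.volume_Icc, sub_zero, ENNReal.toReal_mul, ENNReal.toReal_inv,
    ENNReal.toReal_ofReal hb.le, ENNReal.toReal_ofReal (le_min hx hb.le)]
  field_simp

theorem integral_winShare {s x r b : ℝ} (hs : 0 ≤ s ∧ s ≤ 1) (hb : 0 < b) (hr0 : 0 ≤ r)
    (hr1 : r ≤ 1) (hx : 0 ≤ x) :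
    ∫ y, winShare s x y ∂zeroUnifMix r b = (1 - r) * winShare s x 0 + r * (min x b / b) := by
  have := cond_Icc_isProb hb
  have hi : ∀ μ : Measure ℝ, IsFiniteMeasure μ → Integrable (fun y => winShare s x y) μ :=
    fun μ _ => integrable_winShare hs measurable_const measurable_id
  rw [zeroUnifMix, integral_mix _ _ hr0 hr1 (hi _ inferInstance) (hi _ inferInstance),
    integral_dirac,
    integral_winShare_cond hb hx]

theorem integral_winShare_le {s x r b : ℝ} (hs : 0 ≤ s ∧ s ≤ 1) (hb : 0 < b) (hr0 : 0 ≤ r)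
    (hr1 : r ≤ 1) (hx : 0 ≤ x) :
    ∫ y, winShare s x y ∂zeroUnifMix r b ≤ 1 - r + r * (x / b) := by
  rw [integral_winShare hs hb hr0 hr1 hx]
  have h1 : (1 - r) * winShare s x 0 ≤ (1 - r) * 1 :=
    mul_le_mul_of_nonneg_left (winShare_mem hs).2 (by linarith)
  have h2 : r * (min x b / b) ≤ r * (x / b) := by gcongr; exact min_le_left _ _
  linarith

theorem integral_winShare_eq {s x r b : ℝ} (hs : 0 ≤ s ∧ s ≤ 1) (hb : 0 < b) (hr0 : 0 ≤ r)
    (hr1 : r ≤ 1) (hx : 0 ≤ x) (hxb : x ≤ b) (h : 0 < x ∨ r = 1) :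
    ∫ y, winShare s x y ∂zeroUnifMix r b = 1 - r + r * (x / b) := by
  rw [integral_winShare hs hb hr0 hr1 hx, min_eq_left hxb]
  rcases h with h | h
  · simp [winShare, h]
  · simp [h]

section Payoff

variable {n : ℕ} {V s r b : Fin n → ℝ} {c T : ℝ} {μ ν : Measure (Fin n → ℝ)}

theorem integral_prod_winShare (hs : ∀ i, 0 ≤ s i ∧ s i ≤ 1) {P : Fin n → Measure ℝ}
    [IsProbabilityMeasure μ] (hν : IsCoupling ν P) :
    ∫ z, ∑ i, V i * winShare (s i) (z.1 i) (z.2 i) ∂(μ.prod ν) =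
      ∫ x, ∑ i, V i * ∫ y, winShare (s i) (x i) y ∂P i ∂μ := by
  have := hν.isProb
  have hint : ∀ i, Integrable (fun z : (Fin n → ℝ) × (Fin n → ℝ) =>
      V i * winShare (s i) (z.1 i) (z.2 i)) (μ.prod ν) := fun i =>
    (integrable_winShare (hs i) (by fun_prop) (by fun_prop)).const_mul _
  rw [integral_prod _ (integrable_finsetSum _ fun i _ => hint i)]
  congr 1
  ext x
  rw [integral_finsetSum _ fun i _ =>
    (integrable_winShare (hs i) measurable_const (by fun_prop)).const_mul _]
  refine Finset.sum_congr rfl fun i _ => ?_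
  rw [integral_const_mul, ← hν.marginal i, integral_map (measurable_pi_apply i).aemeasurable]
  exact ((measurable_winShare (s i)).comp
    (measurable_const.prodMk measurable_id)).aestronglyMeasurable

theorem integrable_expected_winShare (hs : ∀ i, 0 ≤ s i ∧ s i ≤ 1) {P : Fin n → Measure ℝ}
    [IsProbabilityMeasure μ] (hν : IsCoupling ν P) :
    Integrable (fun x => ∑ i, V i * ∫ y, winShare (s i) (x i) y ∂P i) μ := by
  have := hν.isProb
  refine integrable_finsetSum _ fun i _ => Integrable.const_mul ?_ _
  have h := (integrable_winShare (μ := μ.prod ν) (hs i)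
    (f := fun z => z.1 i) (g := fun z => z.2 i) (by fun_prop) (by fun_prop)).integral_prod_left
  refine h.congr (ae_of_all _ fun x => ?_)
  beta_reduce
  rw [← hν.marginal i, integral_map (measurable_pi_apply i).aemeasurable]
  exact ((measurable_winShare (s i)).comp
    (measurable_const.prodMk measurable_id)).aestronglyMeasurable

/-- By `hc` a unit of budget is worth `c` on every battlefield, so only the total allocation counts.
-/
theorem sum_share_eq (hb : ∀ i, 0 < b i) (hc : ∀ i, V i * r i = c * b i) (x : Fin n → ℝ) :
    ∑ i, V i * (1 - r i + r i * (x i / b i)) = ∑ i, V i * (1 - r i) + c * ∑ i, x i := by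
  rw [Finset.mul_sum, ← Finset.sum_add_distrib]
  refine Finset.sum_congr rfl fun i _ => ?_
  have := (hb i).ne'
  have h : V i * (r i * (x i / b i)) = c * x i := by
    rw [← mul_assoc, hc]
    field_simp
  rw [mul_add, h]

/-- No strategy with budget `T` earns more than the Lotto value against Lotto marginals. -/
theorem payoff_le (hV : ∀ i, 0 ≤ V i) (hs : ∀ i, 0 ≤ s i ∧ s i ≤ 1) (hb : ∀ i, 0 < b i)
    (hr : ∀ i, 0 ≤ r i ∧ r i ≤ 1) (hc0 : 0 ≤ c) (hc : ∀ i, V i * r i = c * b i)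
    (hμ : IsBlottoStrategy T μ) (hν : IsCoupling ν fun i => zeroUnifMix (r i) (b i)) :
    ∫ z, ∑ i, V i * winShare (s i) (z.1 i) (z.2 i) ∂(μ.prod ν) ≤
      ∑ i, V i * (1 - r i) + c * T := by
  have := hμ.isProb
  rw [integral_prod_winShare hs hν]
  calc _ ≤ ∫ _, (∑ i, V i * (1 - r i) + c * T) ∂μ := by
        refine integral_mono_ae (integrable_expected_winShare hs hν) (integrable_const _) ?_
        filter_upwards [hμ.nonneg, hμ.budget] with x hx0 hxT
        calc _ ≤ ∑ i, V i * (1 - r i + r i * (x i / b i)) :=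
              Finset.sum_le_sum fun i _ => mul_le_mul_of_nonneg_left
                (integral_winShare_le (hs i) (hb i) (hr i).1 (hr i).2 (hx0 i)) (hV i)
          _ = _ := sum_share_eq hb hc x
          _ ≤ _ := by gcongr
    _ = _ := by simp

/-- A coupling of Lotto marginals with constant sum `T` earns the Lotto value. -/
theorem payoff_eq (hs : ∀ i, 0 ≤ s i ∧ s i ≤ 1) (hb : ∀ i, 0 < b i)
    (hr : ∀ i, 0 ≤ r i ∧ r i ≤ 1) (hc : ∀ i, V i * r i = c * b i) {p : Fin n → ℝ}
    (hpr : ∀ i, p i = 1 ∨ r i = 1)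
    (hμ : IsCoupling μ fun i => zeroUnifMix (p i) (b i)) (hT : ∀ᵐ x ∂μ, ∑ i, x i = T)
    (hν : IsCoupling ν fun i => zeroUnifMix (r i) (b i)) :
    ∫ z, ∑ i, V i * winShare (s i) (z.1 i) (z.2 i) ∂(μ.prod ν) =
      ∑ i, V i * (1 - r i) + c * T := by
  have := hμ.isProb
  rw [integral_prod_winShare hs hν]
  -- This removes the tie-breaking rule: if the opponent may have an atom at 0, the own law has
  -- none.
  have h1 : ∀ i, ∀ᵐ x ∂μ, 0 ≤ x i ∧ x i ≤ b i ∧ (0 < x i ∨ r i = 1) := fun i => by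
    rcases hpr i with h | h
    · have := hμ.ae_of_ae (i := i) (by rw [h]; exact ae_zeroUnifMix_one (b i))
      filter_upwards [this] with x hx
      exact ⟨hx.1.le, hx.2, Or.inl hx.1⟩
    · filter_upwards [hμ.ae_of_ae (i := i) (ae_zeroUnifMix (hb i))] with x hx
      exact ⟨hx.1, hx.2, Or.inr h⟩
  have h2 : (fun x => ∑ i, V i * ∫ y, winShare (s i) (x i) y ∂zeroUnifMix (r i) (b i)) =ᵐ[μ]
      fun _ => ∑ i, V i * (1 - r i) + c * T := by
    filter_upwards [ae_all_iff.2 h1, hT] with x hx hxT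
    rw [← hxT, ← sum_share_eq hb hc x]
    exact Finset.sum_congr rfl fun i _ => by
      rw [integral_winShare_eq (hs i) (hb i) (hr i).1 (hr i).2 (hx i).1 (hx i).2.1 (hx i).2.2]
  rw [integral_congr_ae h2]
  simp

end Payoff

/-! ### Lengths and weights of the Lotto solution, and equilibrium -/

namespace BlottoGame

variable {n : ℕ} (G : BlottoGame n) {g l : ℝ}

/-- The common length of the intervals of the Lotto solution. -/
noncomputable def lottoLength (g l : ℝ) (i : Fin n) : ℝ := min (G.vA i) (g * G.vB i) / l

/-- The probability that player `A` competes for battlefield `i`. -/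
noncomputable def lottoWeightA (g : ℝ) (i : Fin n) : ℝ :=
  if G.vA i < g * G.vB i then G.vA i / (g * G.vB i) else 1

/-- The probability that player `B` competes for battlefield `i`. -/
noncomputable def lottoWeightB (g : ℝ) (i : Fin n) : ℝ :=
  if G.vA i < g * G.vB i then 1 else g * G.vB i / G.vA i

theorem zeroUnifMix_one (b : ℝ) :
    zeroUnifMix 1 b = ProbabilityTheory.cond volume (Set.Icc 0 b) := by
  simp [zeroUnifMix]

theorem lottoMarginalA_eq (i : Fin n) :
    G.lottoMarginalA g l i = zeroUnifMix (G.lottoWeightA g i) (G.lottoLength g l i) := by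
  unfold lottoMarginalA lottoWeightA lottoLength
  have hB := G.vB_pos i
  split_ifs with h1 h2 h2 <;> rw [le_div_iff₀ hB] at h1
  · linarith
  · rw [min_eq_right h1, zeroUnifMix_one]
  · rw [min_eq_left h2.le]
  · linarith

theorem lottoMarginalB_eq (i : Fin n) :
    G.lottoMarginalB g l i = zeroUnifMix (G.lottoWeightB g i) (G.lottoLength g l i) := by
  unfold lottoMarginalB lottoWeightB lottoLength
  have hB := G.vB_pos i
  split_ifs with h1 h2 h2 <;> rw [le_div_iff₀ hB] at h1
  · linarith
  · rw [min_eq_right h1]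
  · rw [min_eq_left h2.le, zeroUnifMix_one]
  · linarith

theorem lottoLength_pos (hg : 0 < g) (hl : 0 < l) (i : Fin n) : 0 < G.lottoLength g l i :=
  div_pos (lt_min (G.vA_pos i) (mul_pos hg (G.vB_pos i))) hl

theorem lottoWeightA_mem (hg : 0 < g) (i : Fin n) :
    0 ≤ G.lottoWeightA g i ∧ G.lottoWeightA g i ≤ 1 := by
  have hA := G.vA_pos i
  have hB := mul_pos hg (G.vB_pos i)
  unfold lottoWeightA
  split_ifs with h
  · exact ⟨by positivity, div_le_one_of_le₀ h.le hB.le⟩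
  · simp

theorem lottoWeightB_mem (hg : 0 < g) (i : Fin n) :
    0 ≤ G.lottoWeightB g i ∧ G.lottoWeightB g i ≤ 1 := by
  have hA := G.vA_pos i
  have hB := mul_pos hg (G.vB_pos i)
  unfold lottoWeightB
  split_ifs with h
  · simp
  · exact ⟨by positivity, div_le_one_of_le₀ (not_lt.1 h) hA.le⟩

/-- The slope common to all battlefields is `l` for player A; for player B it is `l / g`. -/
theorem vA_mul_lottoWeightB (hl : 0 < l) (i : Fin n) :
    G.vA i * G.lottoWeightB g i = l * G.lottoLength g l i := by
  have hA := (G.vA_pos i).ne'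
  unfold lottoWeightB lottoLength
  split_ifs with h
  · rw [min_eq_left h.le]
    field_simp
  · rw [min_eq_right (not_lt.1 h)]
    field_simp

theorem vB_mul_lottoWeightA (hg : 0 < g) (hl : 0 < l) (i : Fin n) :
    G.vB i * G.lottoWeightA g i = l / g * G.lottoLength g l i := by
  have hA := (G.vB_pos i).ne'
  unfold lottoWeightA lottoLength
  split_ifs with h
  · rw [min_eq_left h.le]
    field_simp
  · rw [min_eq_right (not_lt.1 h)]
    field_simp

/-- The mean of Unif[0, b] is b / 2, so the budget equation says that the expected total allocation
is the budget. -/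
theorem sum_lottoWeightA (h : G.IsLottoParam g l) :
    ∑ i, G.lottoWeightA g i * G.lottoLength g l i = 2 * G.TA := by
  have hl := h.l_pos
  have hg := h.g_pos
  apply mul_left_cancel₀ hl.ne'
  rw [show l * (2 * G.TA) = 2 * (l * G.TA) by ring, h.budgetA, Finset.mul_sum, Finset.mul_sum,
    Finset.mul_sum]
  refine Finset.sum_congr rfl fun i _ => ?_
  have hA := G.vA_pos i
  have hB := mul_pos hg (G.vB_pos i)
  unfold lottoWeightA lottoLength
  split_ifs with h
  · rw [min_eq_left h.le, min_eq_right]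
    · field_simp
    · rw [div_le_iff₀ hB]
      nlinarith
  · have h' := not_lt.1 h
    rw [min_eq_right h', min_eq_left]
    · field_simp
    · rw [le_div_iff₀ hB]
      nlinarith

theorem sum_lottoWeightB (h : G.IsLottoParam g l) :
    ∑ i, G.lottoWeightB g i * G.lottoLength g l i = 2 * G.TB := by
  have hl := h.l_pos
  have hg := h.g_pos
  apply mul_left_cancel₀ hl.ne'
  rw [show l * (2 * G.TB) = 2 * (l * G.TB) by ring, h.budgetB, Finset.mul_sum, Finset.mul_sum,
    Finset.mul_sum]
  refine Finset.sum_congr rfl fun i _ => ?_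
  have hA := G.vA_pos i
  have hB := mul_pos hg (G.vB_pos i)
  unfold lottoWeightB lottoLength
  split_ifs with h
  · rw [min_eq_left h.le, min_eq_right]
    · field_simp
    · rw [le_div_iff₀ hA]
      nlinarith
  · have h' := not_lt.1 h
    rw [min_eq_right h', min_eq_left]
    · field_simp
    · rw [div_le_iff₀ hA]
      nlinarith

/-- Couplings of the Lotto marginals which exhaust the budgets are an equilibrium. -/
theorem isBlottoNash_of_isCoupling (hg : 0 < g) (hl : 0 < l) {τ : Fin n → ℝ}
    (hτ : ∀ i, 0 ≤ τ i ∧ τ i ≤ 1) {μ ν : Measure (Fin n → ℝ)}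
    (hμ : IsCoupling μ fun i => zeroUnifMix (G.lottoWeightA g i) (G.lottoLength g l i))
    (hν : IsCoupling ν fun i => zeroUnifMix (G.lottoWeightB g i) (G.lottoLength g l i))
    (hμT : ∀ᵐ x ∂μ, ∑ i, x i = G.TA) (hνT : ∀ᵐ x ∂ν, ∑ i, x i = G.TB) :
    G.IsBlottoNash τ μ ν := by
  have hb := G.lottoLength_pos hg hl
  have hτ' : ∀ i, 0 ≤ 1 - τ i ∧ 1 - τ i ≤ 1 := fun i =>
    ⟨by linarith [(hτ i).2], by linarith [(hτ i).1]⟩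
  have hB : ∀ (μ ν : Measure (Fin n → ℝ)), IsProbabilityMeasure μ → IsProbabilityMeasure ν →
      G.payoffB τ μ ν =
        ∫ z, ∑ i, G.vB i * winShare (1 - τ i) (z.1 i) (z.2 i) ∂(ν.prod μ) := by
    intro μ ν _ _
    rw [payoffB, ← integral_prod_swap]
    rfl
  have hone : ∀ i, G.lottoWeightA g i = 1 ∨ G.lottoWeightB g i = 1 := fun i => by
    unfold lottoWeightA lottoWeightB
    split_ifs <;> simp
  refine ⟨hμ.isBlottoStrategy hb hμT, hν.isBlottoStrategy hb hνT, fun μ' hμ' => ?_,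
    fun ν' hν' => ?_⟩
  · unfold payoffA
    rw [payoff_eq hτ hb (G.lottoWeightB_mem hg) (G.vA_mul_lottoWeightB hl) hone hμ hμT hν]
    exact payoff_le (fun i => (G.vA_pos i).le) hτ hb (G.lottoWeightB_mem hg) hl.le
      (G.vA_mul_lottoWeightB hl) hμ' hν
  · rw [hB _ _ hμ.isProb hν.isProb, hB _ _ hμ.isProb hν'.isProb,
      payoff_eq hτ' hb (G.lottoWeightA_mem hg) (G.vB_mul_lottoWeightA hg hl)
        (fun i => (hone i).symm) hν hνT hμ]
    exact payoff_le (fun i => (G.vB_pos i).le) hτ' hb (G.lottoWeightA_mem hg)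
      (div_nonneg hl.le hg.le) (G.vB_mul_lottoWeightA hg hl) hν' hμ

end BlottoGame

/-! ### Decomposition of a weight vector into vertices -/

namespace VertexPeeling

/-- The entry of the greedy vertex: settled coordinates keep their value, the others are filled
from the remainder `R`. -/
noncomputable def fillValue (c y W R : ℝ) : ℝ :=
  if y < W then (if 0 < y then (if R < c then R / c else 1) else 0) else 1

noncomputable def fillNext (c y W R : ℝ) : ℝ :=
  if y < W then (if 0 < y then (if R < c then 0 else R - c) else R) else R

noncomputable def fillRem (c y : ℕ → ℝ) (W R : ℝ) : ℕ → ℝ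
  | 0 => R
  | i + 1 => fillNext (c i) (y i) W (fillRem c y W R i)

/-- The greedy vertex. -/
noncomputable def fill (c y : ℕ → ℝ) (W R : ℝ) (i : ℕ) : ℝ :=
  fillValue (c i) (y i) W (fillRem c y W R i)

/-- The amount left for the coordinates that are not settled at the upper bound. -/
noncomputable def slack (n : ℕ) (c y : ℕ → ℝ) (W Θ : ℝ) : ℝ :=
  Θ - ∑ i ∈ Finset.range n, if y i < W then 0 else c i

/-- Lowers `θ` just enough for y - θ * v to stay nonnegative. `capUpper` does the same for the
distance W - y to the upper bound. -/
noncomputable def capLower (y v θ : ℝ) : ℝ := if 0 < v then (if y < θ * v then y / v else θ) else θ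

noncomputable def capUpper (y v W θ : ℝ) : ℝ :=
  if v < 1 then (if W - y < θ * (1 - v) then (W - y) / (1 - v) else θ) else θ

/-- The largest weight with which the vertex `v` can be peeled off, over the first coordinates. -/
noncomputable def cap (y v : ℕ → ℝ) (W : ℝ) : ℕ → ℝ
  | 0 => W
  | i + 1 => capUpper (y i) (v i) W (capLower (y i) (v i) (cap y v W i))

/-- A vertex of the slice `∑ c i * v i = Θ` of the unit cube. -/
structure IsVertex (n : ℕ) (c : ℕ → ℝ) (Θ : ℝ) (v : ℕ → ℝ) : Prop where
  mem : ∀ i < n, 0 ≤ v i ∧ v i ≤ 1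
  sum : ∑ i ∈ Finset.range n, c i * v i = Θ
  sub : ∀ i < n, ∀ j < n, 0 < v i → v i < 1 → 0 < v j → v j < 1 → i = j

/-- A point of the slice with total weight `W`. -/
structure IsPoint (n : ℕ) (c : ℕ → ℝ) (Θ : ℝ) (y : ℕ → ℝ) (W : ℝ) : Prop where
  mem : ∀ i < n, 0 ≤ y i ∧ y i ≤ W
  sum : ∑ i ∈ Finset.range n, c i * y i = W * Θ

/-- The unsettled coordinates. -/
noncomputable def unsettled (n : ℕ) (y : ℕ → ℝ) (W : ℝ) : Finset ℕ :=
  (Finset.range n).filter fun i => 0 < y i ∧ y i < W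

theorem mem_unsettled {n : ℕ} {y : ℕ → ℝ} {W : ℝ} {i : ℕ} :
    i ∈ unsettled n y W ↔ i < n ∧ 0 < y i ∧ y i < W := by
  simp [unsettled]

section Fill

variable {n : ℕ} {c y : ℕ → ℝ} {W Θ : ℝ}

/-- The remainder never exceeds what the unsettled coordinates still to come can absorb, so it is 0
at the end. At the start, W times the slack is the sum of c j * y j over y j < W, where coordinates
at 0 contribute nothing and the others at most W * c j. -/
theorem fillRem_mem (hc : ∀ i < n, 0 < c i) (hW : 0 < W) (h : IsPoint n c Θ y W) (i : ℕ)
    (hi : i ≤ n) :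
    0 ≤ fillRem c y W (slack n c y W Θ) i ∧ fillRem c y W (slack n c y W Θ) i ≤
      ∑ j ∈ Finset.Ico i n, if 0 < y j ∧ y j < W then c j else 0 := by
  induction i with
  | zero =>
    have h1 : W * slack n c y W Θ =
        ∑ j ∈ Finset.range n, if y j < W then c j * y j else 0 := by
      rw [slack, mul_sub, ← h.sum, Finset.mul_sum, ← Finset.sum_sub_distrib]
      refine Finset.sum_congr rfl fun j hj => ?_
      have := h.mem j (Finset.mem_range.1 hj)
      split_ifs with h2
      · ring
      · rw [le_antisymm this.2 (not_lt.1 h2)]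
        ring
    rw [fillRem]
    constructor
    · by_contra hneg
      have h2 : 0 ≤ W * slack n c y W Θ := by
        rw [h1]
        refine Finset.sum_nonneg fun j hj => ?_
        have hj := Finset.mem_range.1 hj
        split_ifs
        · exact mul_nonneg (hc j hj).le (h.mem j hj).1
        · exact le_rfl
      nlinarith
    · refine le_of_mul_le_mul_left ?_ hW
      rw [h1, Finset.mul_sum, Finset.range_eq_Ico]
      refine Finset.sum_le_sum fun j hj => ?_
      have hj := (Finset.mem_Ico.1 hj).2
      have hm := h.mem j hj
      by_cases h0 : 0 < y j <;> by_cases h2 : y j < W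
      · simp only [h0, h2, and_self, if_true]
        nlinarith [hc j hj]
      · simp [h2]
      · simp [le_antisymm (not_lt.1 h0) hm.1]
      · simp [h2]
  | succ i ih =>
    obtain ⟨h1, h2⟩ := ih (by omega)
    rw [Finset.sum_eq_sum_Ico_succ_bot (by omega)] at h2
    have hn : 0 ≤ ∑ j ∈ Finset.Ico (i + 1) n, if 0 < y j ∧ y j < W then c j else 0 := by
      refine Finset.sum_nonneg fun j hj => ?_
      split_ifs
      · exact (hc j (Finset.mem_Ico.1 hj).2).le
      · exact le_rfl
    rw [fillRem, fillNext]
    split_ifs with h3 h4 h5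
    · exact ⟨le_rfl, hn⟩
    · rw [if_pos ⟨h4, h3⟩] at h2
      constructor <;> linarith
    · rw [if_neg (by tauto), zero_add] at h2
      exact ⟨h1, h2⟩
    · rw [if_neg (by tauto), zero_add] at h2
      exact ⟨h1, h2⟩

theorem sum_fill (hc : ∀ i < n, 0 < c i) (i : ℕ) (hi : i ≤ n) :
    ∑ j ∈ Finset.range i, c j * fill c y W (slack n c y W Θ) j +
      fillRem c y W (slack n c y W Θ) i =
    slack n c y W Θ + ∑ j ∈ Finset.range i, if y j < W then 0 else c j := by
  induction i with
  | zero => simp [fillRem]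
  | succ i ih =>
    have ih := ih (by omega)
    have hci := (hc i (by omega)).ne'
    rw [Finset.sum_range_succ, Finset.sum_range_succ, fillRem, fill, fillValue, fillNext]
    split_ifs
    · rw [mul_div_cancel₀ _ hci]; linarith
    · linarith
    · linarith
    · linarith

/-- A fractional entry arises only when the remainder is too small to fill the coordinate; the
remainder is then used up, and all later entries are 0 or 1. -/
theorem fill_isVertex (hc : ∀ i < n, 0 < c i) (hW : 0 < W) (h : IsPoint n c Θ y W) :
    IsVertex n c Θ (fill c y W (slack n c y W Θ)) := by
  obtain ⟨R, hR⟩ : ∃ R, R = slack n c y W Θ := ⟨_, rfl⟩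
  have hrem := fillRem_mem hc hW h
  have hsum := sum_fill (y := y) (W := W) (Θ := Θ) hc n le_rfl
  have hzero : ∀ i < n, fillRem c y W R i = 0 → ∀ j, i ≤ j → j ≤ n → fillRem c y W R j = 0 := by
    intro i hi h0 j hij
    induction j, hij using Nat.le_induction with
    | base => exact fun _ => h0
    | succ j hij ih =>
      intro hjn
      have := hc j (by omega)
      rw [fillRem, fillNext, ih (by omega)]
      simp [this]
  have hkey : ∀ i j, i < j → j < n → 0 < fill c y W R i → fill c y W R i < 1 →
      0 < fill c y W R j → fill c y W R j < 1 → False := by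
    intro i j hij hj h1 h2 h3 h4
    have h5 : fillRem c y W R (i + 1) = 0 := by
      rw [fill, fillValue] at h1 h2
      rw [fillRem, fillNext]
      split_ifs at h1 h2 ⊢ <;> first | rfl | (exfalso; linarith)
    have h6 := hzero (i + 1) (by omega) h5 j (by omega) hj.le
    have := hc j hj
    rw [fill, fillValue, h6] at h3 h4
    split_ifs at h3 h4 <;> simp_all
  rw [← hR] at hrem hsum ⊢
  refine ⟨fun i hi => ?_, ?_, fun i hi j hj h1 h2 h3 h4 => ?_⟩
  · have h1 := (hrem i hi.le).1
    have h2 := hc i hi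
    rw [fill, fillValue]
    split_ifs with _ _ h5
    · exact ⟨div_nonneg h1 h2.le, div_le_one_of_le₀ h5.le h2.le⟩
    all_goals simp
  · obtain ⟨h1, h2⟩ := hrem n le_rfl
    rw [Finset.Ico_self, Finset.sum_empty] at h2
    rw [le_antisymm h2 h1, add_zero] at hsum
    rw [hsum, hR, slack]
    ring
  · rcases lt_trichotomy i j with hij | hij | hij
    · exact (hkey i j hij hj h1 h2 h3 h4).elim
    · exact hij
    · exact (hkey j i hij hi h3 h4 h1 h2).elim

/-- The greedy vertex therefore lies in the smallest face containing y / W. -/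
theorem fill_of_settled (R : ℝ) {i : ℕ} (h0 : 0 ≤ y i) (h1 : y i ≤ W)
    (h : ¬ (0 < y i ∧ y i < W)) : W * fill c y W R i = y i := by
  rw [fill, fillValue]
  split_ifs with h2 h3
  · exact absurd ⟨h3, h2⟩ h
  · exact absurd ⟨h3, h2⟩ h
  · rw [mul_zero]; exact le_antisymm h0 (not_lt.1 h3)
  · rw [mul_one]; exact le_antisymm (not_lt.1 h2) h1

end Fill

section Cap

variable {n : ℕ} {y v : ℕ → ℝ} {W : ℝ}

theorem capLower_spec {y v θ : ℝ} (hy : 0 ≤ y) (hv : 0 ≤ v) (hθ : 0 ≤ θ) :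
    0 ≤ capLower y v θ ∧ capLower y v θ ≤ θ ∧ capLower y v θ * v ≤ y ∧
      (capLower y v θ = θ ∨ 0 < v ∧ y = capLower y v θ * v) := by
  unfold capLower
  split_ifs with h1 h2
  · refine ⟨by positivity, (div_le_iff₀ h1).2 h2.le, (div_mul_cancel₀ _ h1.ne').le,
      Or.inr ⟨h1, (div_mul_cancel₀ _ h1.ne').symm⟩⟩
  · exact ⟨hθ, le_rfl, not_lt.1 h2, Or.inl rfl⟩
  · have : v = 0 := le_antisymm (not_lt.1 h1) hv
    simp [this, hy, hθ]

theorem capUpper_eq (y v W θ : ℝ) : capUpper y v W θ = capLower (W - y) (1 - v) θ := by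
  simp [capUpper, capLower]

/-- A running minimum: either no bound is active or one is attained. The strict signs at the
attained bound exclude bounds that hold trivially, and make it possible to recognise a newly settled
coordinate. -/
theorem cap_spec (hy : ∀ i < n, 0 ≤ y i ∧ y i ≤ W) (hv : ∀ i < n, 0 ≤ v i ∧ v i ≤ 1)
    (hW : 0 ≤ W) (i : ℕ) (hi : i ≤ n) :
    0 ≤ cap y v W i ∧ cap y v W i ≤ W ∧
      (∀ j < i, cap y v W i * v j ≤ y j ∧ cap y v W i * (1 - v j) ≤ W - y j) ∧
      (cap y v W i = W ∨ ∃ j < i, 0 < v j ∧ y j = cap y v W i * v j ∨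
        v j < 1 ∧ W - y j = cap y v W i * (1 - v j)) := by
  induction i with
  | zero => simp [cap, hW]
  | succ i ih =>
    obtain ⟨h0, h1, h2, h3⟩ := ih (by omega)
    have hyi := hy i (by omega)
    have hvi := hv i (by omega)
    obtain ⟨a0, a1, a2, a3⟩ := capLower_spec hyi.1 hvi.1 h0
    obtain ⟨b0, b1, b2, b3⟩ := capLower_spec (sub_nonneg.2 hyi.2) (sub_nonneg.2 hvi.2) a0
    rw [← capUpper_eq] at b0 b1 b2 b3
    rw [cap]
    refine ⟨b0, b1.trans (a1.trans h1), fun j hj => ?_, ?_⟩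
    · rcases Nat.lt_succ_iff_lt_or_eq.1 hj with hj' | rfl
      · have hvj := hv j (by omega)
        exact ⟨(mul_le_mul_of_nonneg_right (b1.trans a1) hvj.1).trans (h2 j hj').1,
          (mul_le_mul_of_nonneg_right (b1.trans a1) (by linarith [hvj.2])).trans (h2 j hj').2⟩
      · exact ⟨(mul_le_mul_of_nonneg_right b1 hvi.1).trans a2, b2⟩
    · rcases b3 with b3 | b3
      · rw [b3]
        rcases a3 with a3 | a3
        · rw [a3]
          rcases h3 with h3 | ⟨j, hj, h3⟩
          · exact Or.inl h3
          · exact Or.inr ⟨j, by omega, h3⟩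
        · exact Or.inr ⟨i, by omega, Or.inl a3⟩
      · exact Or.inr ⟨i, by omega, Or.inr ⟨by linarith [b3.1], b3.2⟩⟩

end Cap

/-- Peeling the vertex `v` off the point `y`. -/
theorem peel_isPoint {n : ℕ} {c y v : ℕ → ℝ} {W Θ : ℝ} (h : IsPoint n c Θ y W)
    (hv : IsVertex n c Θ v) (hW : 0 ≤ W) :
    IsPoint n c Θ (fun i => y i - cap y v W n * v i) (W - cap y v W n) := by
  obtain ⟨h0, h1, h2, -⟩ := cap_spec h.mem hv.mem hW n le_rfl
  refine ⟨fun i hi => ?_, ?_⟩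
  · have := h2 i hi
    constructor <;> linarith
  · simp only [mul_sub, Finset.sum_sub_distrib]
    have h3 : ∑ i ∈ Finset.range n, c i * (cap y v W n * v i) = cap y v W n * Θ := by
      rw [← hv.sum, Finset.mul_sum]
      exact Finset.sum_congr rfl fun i _ => by ring
    rw [h.sum, h3]
    ring

section Progress

variable {n : ℕ} {c y v : ℕ → ℝ} {W Θ : ℝ}

/-- Peeling off a vertex of the minimal face settles a new coordinate. -/
theorem card_unsettled_lt (h : IsPoint n c Θ y W) (hv : IsVertex n c Θ v) (hW : 0 < W)
    (hset : ∀ i < n, ¬ (0 < y i ∧ y i < W) → W * v i = y i) (hne : cap y v W n ≠ W) :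
    (unsettled n (fun i => y i - cap y v W n * v i) (W - cap y v W n)).card <
      (unsettled n y W).card := by
  obtain ⟨h0, h1, h2, h3⟩ := cap_spec h.mem hv.mem hW.le n le_rfl
  generalize cap y v W n = θ at *
  have hlt : θ < W := lt_of_le_of_ne h1 hne
  have hback : ∀ i < n, ¬ (0 < y i ∧ y i < W) →
      ¬ (0 < y i - θ * v i ∧ y i - θ * v i < W - θ) := by
    intro i hi hs
    have hs' := hset i hi hs
    have hm := h.mem i hi
    rintro ⟨e1, e2⟩
    apply hs
    constructor
    · by_contra hy
      have : y i = 0 := le_antisymm (not_lt.1 hy) hm.1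
      have : v i = 0 := by
        rw [this] at hs'
        exact (mul_eq_zero.1 hs').resolve_left hW.ne'
      simp_all
    · by_contra hy
      have h4 : y i = W := le_antisymm hm.2 (not_lt.1 hy)
      have : v i = 1 := by
        rw [h4] at hs'
        exact mul_left_cancel₀ hW.ne' (by linarith)
      rw [h4, this] at e2
      linarith
  refine Finset.card_lt_card (Finset.ssubset_iff_subset_ne.2 ⟨fun i hi => ?_, fun heq => ?_⟩)
  · rw [mem_unsettled] at hi ⊢
    refine ⟨hi.1, ?_⟩
    by_contra hs
    exact hback i hi.1 hs hi.2
  -- The coordinate j of the attained bound is settled after peeling. Had it been settled before,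
  -- `hset` and the strict sign in `h3` would give θ = W.
  · obtain ⟨j, hj, h3⟩ := h3.resolve_left hne
    have hnot : j ∉ unsettled n (fun i => y i - θ * v i) (W - θ) := by
      rw [mem_unsettled]
      rintro ⟨-, e1, e2⟩
      rcases h3 with h3 | h3
      · linarith [h3.2]
      · linarith [h3.2]
    rw [heq, mem_unsettled] at hnot
    have hs := hset j hj (fun hs => hnot ⟨hj, hs⟩)
    rcases h3 with h3 | h3
    · have := h3.2
      rw [← hs] at this
      nlinarith [h3.1]
    · have := h3.2
      rw [← hs] at this
      nlinarith [h3.1]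

/-- With at most one unsettled coordinate, the point is proportional to a vertex. -/
theorem cap_eq_of_card_le_one (hc : ∀ i < n, 0 < c i) (h : IsPoint n c Θ y W)
    (hv : IsVertex n c Θ v) (hW : 0 < W)
    (hset : ∀ i < n, ¬ (0 < y i ∧ y i < W) → W * v i = y i)
    (hcard : (unsettled n y W).card ≤ 1) : cap y v W n = W := by
  -- The two points agree off one coordinate and have the same weighted sum, so they agree there
  -- too.
  have hall : ∀ i < n, W * v i = y i := by
    intro i hi
    by_contra hne
    have hi' : i ∈ unsettled n y W := by
      rw [mem_unsettled]
      refine ⟨hi, ?_⟩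
      by_contra hs
      exact hne (hset i hi hs)
    have h1 : ∑ j ∈ Finset.range n, c j * (W * v j - y j) = 0 := by
      simp only [mul_sub, Finset.sum_sub_distrib]
      rw [h.sum, ← hv.sum, Finset.mul_sum, sub_eq_zero]
      exact Finset.sum_congr rfl fun j _ => by ring
    rw [Finset.sum_eq_single_of_mem i (Finset.mem_range.2 hi)] at h1
    · rcases mul_eq_zero.1 h1 with h1 | h1
      · exact (hc i hi).ne' h1
      · exact hne (sub_eq_zero.1 h1)
    · intro j hj hji
      have hj := Finset.mem_range.1 hj
      rw [hset j hj, sub_self, mul_zero]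
      intro hs
      exact hji (Finset.card_le_one.1 hcard j (mem_unsettled.2 ⟨hj, hs⟩) i hi')
  obtain ⟨h0, h1, h2, h3⟩ := cap_spec h.mem hv.mem hW.le n le_rfl
  rcases h3 with h3 | ⟨j, hj, h3⟩
  · exact h3
  · have hj' := hall j hj
    rcases h3 with h3 | h3
    · rw [← hj'] at h3
      exact (mul_right_cancel₀ h3.1.ne' h3.2).symm
    · have e1 : (1 - v j) ≠ 0 := by linarith [h3.1]
      refine (mul_right_cancel₀ e1 ?_).symm
      rw [← h3.2, ← hj']
      ring

end Progress

/-! ### The rounds of the decomposition -/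

/-- The state of the decomposition: the last vertex `v`, its weight `θ`, and the point `y` of
total weight `W` it is to be peeled off. -/
structure Stage where
  y : ℕ → ℝ
  v : ℕ → ℝ
  W : ℝ
  θ : ℝ

namespace Stage

/-- The point left. -/
def rest (s : Stage) (i : ℕ) : ℝ := s.y i - s.θ * s.v i

/-- The weight left. -/
def weight (s : Stage) : ℝ := s.W - s.θ

/-- The next vertex. -/
noncomputable def vertex (n : ℕ) (c : ℕ → ℝ) (Θ : ℝ) (s : Stage) : ℕ → ℝ :=
  if 0 < s.weight then fill c s.rest s.weight (slack n c s.rest s.weight Θ) else s.v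

/-- One round of the decomposition. -/
noncomputable def next (n : ℕ) (c : ℕ → ℝ) (Θ : ℝ) (s : Stage) : Stage where
  y := s.rest
  v := s.vertex n c Θ
  W := s.weight
  θ := cap s.rest (s.vertex n c Θ) s.weight n

variable {n : ℕ} {c : ℕ → ℝ} {Θ : ℝ}

/-- Once no weight is left the last vertex is repeated with weight 0, which fills the list up to n
vertices. A round that leaves weight starts with at least two unsettled coordinates and settles one.
-/
theorem next_spec (hc : ∀ i < n, 0 < c i) {s : Stage} (hp : IsPoint n c Θ s.rest s.weight)
    (hW : 0 ≤ s.weight) (hv : 0 < s.weight ∨ IsVertex n c Θ s.v) :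
    IsVertex n c Θ (s.next n c Θ).v ∧ IsPoint n c Θ (s.next n c Θ).rest (s.next n c Θ).weight ∧
      0 ≤ (s.next n c Θ).θ ∧ 0 ≤ (s.next n c Θ).weight ∧
      ((s.next n c Θ).weight = 0 ∨ (unsettled n s.rest s.weight).card ≠ 0 ∧
        (unsettled n s.rest s.weight).card ≠ 1 ∧
        (unsettled n (s.next n c Θ).rest (s.next n c Θ).weight).card <
          (unsettled n s.rest s.weight).card) := by
  have hvert : IsVertex n c Θ (s.vertex n c Θ) := by
    unfold vertex
    split_ifs with h
    · exact fill_isVertex hc h hp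
    · exact hv.resolve_left h
  obtain ⟨h0, h1, -, -⟩ := cap_spec hp.mem hvert.mem hW n le_rfl
  refine ⟨hvert, peel_isPoint hp hvert hW, h0, sub_nonneg.2 h1, ?_⟩
  rcases hW.eq_or_lt with hW0 | hW0
  · left
    change s.weight - cap s.rest (s.vertex n c Θ) s.weight n = 0
    linarith
  by_cases hcap : cap s.rest (s.vertex n c Θ) s.weight n = s.weight
  · left
    exact sub_eq_zero.2 hcap.symm
  right
  have hset : ∀ i < n, ¬ (0 < s.rest i ∧ s.rest i < s.weight) →
      s.weight * s.vertex n c Θ i = s.rest i := fun i hi hs => by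
    rw [vertex, if_pos hW0]
    exact fill_of_settled _ (hp.mem i hi).1 (hp.mem i hi).2 hs
  have h2 := mt (cap_eq_of_card_le_one hc hp hvert hW0 hset) hcap
  exact ⟨by omega, by omega, card_unsettled_lt hp hvert hW0 hset hcap⟩

/-- The stages of the decomposition of `x`. -/
noncomputable def iter (n : ℕ) (c x : ℕ → ℝ) : ℕ → Stage
  | 0 => ⟨x, 0, 1, 0⟩
  | k + 1 => (iter n c x k).next n c (∑ i ∈ Finset.range n, c i * x i)

variable {x : ℕ → ℝ}

/-- While weight is left and n is positive, the number of unsettled coordinates plus k is at most n.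
Since an unfinished round starts with at least two of them, the weight is exhausted by round n. -/
theorem iter_spec (hc : ∀ i < n, 0 < c i) (hx : ∀ i < n, 0 ≤ x i ∧ x i ≤ 1) (k : ℕ)
    (hk : k ≤ n) :
    IsPoint n c (∑ i ∈ Finset.range n, c i * x i) (iter n c x k).rest (iter n c x k).weight ∧
      0 ≤ (iter n c x k).weight ∧ 0 ≤ (iter n c x k).θ ∧
      (k = 0 ∧ 0 < (iter n c x k).weight ∨
        IsVertex n c (∑ i ∈ Finset.range n, c i * x i) (iter n c x k).v) ∧
      ∑ j ∈ Finset.range k, (iter n c x (j + 1)).θ = 1 - (iter n c x k).weight ∧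
      (∀ i, ∑ j ∈ Finset.range k, (iter n c x (j + 1)).θ * (iter n c x (j + 1)).v i =
        x i - (iter n c x k).rest i) ∧
      ((iter n c x k).weight = 0 ∨ k < n ∧
        (unsettled n (iter n c x k).rest (iter n c x k).weight).card + k ≤ n ∨ n = 0) := by
  induction k with
  | zero =>
    refine ⟨⟨fun i hi => ?_, ?_⟩, ?_, ?_, ?_, ?_, ?_, ?_⟩
    · simpa [iter, rest, weight] using hx i hi
    · simp [iter, rest, weight]
    · simp [iter, weight]
    · simp [iter]
    · simp [iter, weight]
    · simp [iter, weight]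
    · simp [iter, rest]
    · rcases Nat.eq_zero_or_pos n with h | h
      · exact Or.inr (Or.inr h)
      · refine Or.inr (Or.inl ⟨h, ?_⟩)
        rw [add_zero]
        exact (Finset.card_filter_le _ _).trans (Finset.card_range n).le
  | succ k ih =>
    obtain ⟨h1, h2, h3, h4, h5, h6, h7⟩ := ih (by omega)
    obtain ⟨g1, g2, g3, g4, g5⟩ := next_spec hc h1 h2 (h4.imp And.right id)
    refine ⟨g2, g4, g3, Or.inr g1, ?_, fun i => ?_, ?_⟩
    · rw [Finset.sum_range_succ, h5]
      change _ + _ = 1 - ((iter n c x k).weight - (iter n c x (k + 1)).θ)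
      ring
    · rw [Finset.sum_range_succ, h6]
      change _ + _ = x i - ((iter n c x k).rest i - (iter n c x (k + 1)).θ * _)
      ring
    · rcases g5 with g5 | g5
      · exact Or.inl g5
      · rcases h7 with h7 | ⟨h7, h8⟩ | h7
        · exfalso
          refine g5.1 (Finset.card_eq_zero.2 (Finset.eq_empty_of_forall_notMem fun i hi => ?_))
          rw [mem_unsettled, h7] at hi
          linarith [hi.2.1, hi.2.2]
        · refine Or.inr (Or.inl ⟨?_, ?_⟩)
          · omega
          · have := g5.2.2
            change (unsettled n (Stage.next n c _ (iter n c x k)).rest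
              (Stage.next n c _ (iter n c x k)).weight).card + (k + 1) ≤ n
            omega
        · omega

/-- The decomposition of `x` into `n` vertices. -/
theorem iter_decomposition (hn : n ≠ 0) (hc : ∀ i < n, 0 < c i)
    (hx : ∀ i < n, 0 ≤ x i ∧ x i ≤ 1) :
    (∀ k < n, 0 ≤ (iter n c x (k + 1)).θ) ∧
      ∑ k ∈ Finset.range n, (iter n c x (k + 1)).θ = 1 ∧
      (∀ k < n, IsVertex n c (∑ i ∈ Finset.range n, c i * x i) (iter n c x (k + 1)).v) ∧
      ∀ i < n, ∑ k ∈ Finset.range n, (iter n c x (k + 1)).θ * (iter n c x (k + 1)).v i = x i := by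
  obtain ⟨h1, -, -, -, h5, h6, h7⟩ := iter_spec hc hx n le_rfl
  have h0 : (iter n c x n).weight = 0 := by
    rcases h7 with h | h | h
    · exact h
    · omega
    · omega
  refine ⟨fun k hk => (iter_spec hc hx (k + 1) hk).2.2.1, by rw [h5, h0, sub_zero],
    fun k hk => ?_, fun i hi => ?_⟩
  · exact (iter_spec hc hx (k + 1) hk).2.2.2.1.resolve_left (by omega)
  · have := h1.mem i hi
    rw [h6, h0] at *
    linarith

end Stage

end VertexPeeling

/-! ### Reasoning about programs -/

namespace RealRAM

/-- Started in `s`, the program halts within `K` steps in a memory satisfying `Q`. -/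
def Reaches (P : Prog) (s : State) (K : ℕ) (Q : State → Prop) : Prop :=
  ∃ t ≤ K, ∃ s', Exec P s t s' ∧ Q s'

namespace Reaches

variable {P P' : Prog} {s : State} {K K' : ℕ} {Q Q' : State → Prop}

theorem seq (h : Reaches P s K fun s₁ => Reaches P' s₁ K' Q) :
    Reaches (.seq P P') s (K + K') Q := by
  obtain ⟨t, ht, s₁, h1, t', ht', s₂, h2, hQ⟩ := h
  exact ⟨t + t', by omega, s₂, .seq h1 h2, hQ⟩

theorem branch {b : Test} (h : b.Holds s → Reaches P s K Q)
    (h' : ¬ b.Holds s → Reaches P' s K Q) : Reaches (.branch b P P') s (K + 1) Q := by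
  by_cases hb : b.Holds s
  · obtain ⟨t, ht, s', h1, hQ⟩ := h hb
    exact ⟨t + 1, by omega, s', .branchTrue hb h1, hQ⟩
  · obtain ⟨t, ht, s', h1, hQ⟩ := h' hb
    exact ⟨t + 1, by omega, s', .branchFalse hb h1, hQ⟩

theorem mono (h : Reaches P s K Q) (hQ : ∀ s', Q s' → Q' s') : Reaches P s K Q' := by
  obtain ⟨t, ht, s', h1, h2⟩ := h
  exact ⟨t, ht, s', h1, hQ s' h2⟩

theorem le (h : Reaches P s K Q) (hK : K ≤ K') : Reaches P s K' Q := by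
  obtain ⟨t, ht, h⟩ := h
  exact ⟨t, ht.trans hK, h⟩

theorem skip (h : Q s) : Reaches .skip s 1 Q := ⟨1, le_rfl, s, .skip s, h⟩

theorem natConst {r v : ℕ} (h : Q (s.setNat r v)) : Reaches (.natConst r v) s 1 Q :=
  ⟨1, le_rfl, _, .natConst r v s, h⟩

theorem natOp {o : NatOp} {r r₁ r₂ : ℕ} (h : Q (s.setNat r (o.eval (s.nat r₁) (s.nat r₂)))) :
    Reaches (.natOp o r r₁ r₂) s 1 Q := ⟨1, le_rfl, _, .natOp o r r₁ r₂ s, h⟩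

theorem realConst {c : Cell} {v : ℚ} (h : Q (s.setReal c (v : ℝ))) :
    Reaches (.realConst c v) s 1 Q := ⟨1, le_rfl, _, .realConst c v s, h⟩

theorem realCopy {c c₁ : Cell} (h : Q (s.setReal c (s.get c₁))) :
    Reaches (.realCopy c c₁) s 1 Q := ⟨1, le_rfl, _, .realCopy c c₁ s, h⟩

theorem realOp {o : RealOp} {c c₁ c₂ : Cell} (hd : o.Defined (s.get c₂))
    (h : Q (s.setReal c (o.eval (s.get c₁) (s.get c₂)))) :
    Reaches (.realOp o c c₁ c₂) s 1 Q := ⟨1, le_rfl, _, .realOp o c c₁ c₂ s hd, h⟩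

/-- A counting loop with invariant `Inv`. -/
theorem forLoop {r n : ℕ} {Inv : ℕ → State → Prop}
    (hInv : ∀ j s, Inv j s → s.nat 0 = n ∧ s.nat r = j)
    (hbody : ∀ j < n, ∀ s, Inv j s → Reaches P s K (Inv (j + 1))) (h : Inv 0 s) :
    Reaches (.loop (.natLt r 0) P) s (n * (K + 1) + 1) (Inv n) := by
  suffices H : ∀ d j s, j + d = n → Inv j s →
      Reaches (.loop (.natLt r 0) P) s (d * (K + 1) + 1) (Inv n) from H n 0 s (by omega) h
  intro d
  induction d with
  | zero =>
    intro j s hj hs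
    obtain rfl : j = n := by omega
    have hb : ¬ (Test.natLt r 0).Holds s := by
      simp [Test.Holds, (hInv j s hs).1, (hInv j s hs).2]
    exact ⟨1, by omega, s, .loopDone hb, hs⟩
  | succ d ih =>
    intro j s hj hs
    have hb : (Test.natLt r 0).Holds s := by
      simp only [Test.Holds, (hInv j s hs).1, (hInv j s hs).2]
      omega
    obtain ⟨t, ht, s₁, h1, hs₁⟩ := hbody j (by omega) s hs
    obtain ⟨t', ht', s₂, h2, hs₂⟩ := ih (j + 1) s₁ (by omega) hs₁
    refine ⟨t + t' + 1, ?_, s₂, .loopStep hb h1 h2, hs₂⟩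
    rw [Nat.succ_mul]
    omega

end Reaches

namespace State

variable (s : State)

theorem setReal_nat (c : Cell) (v : ℝ) : (s.setReal c v).nat = s.nat := rfl

theorem setNat_real (r v : ℕ) : (s.setNat r v).real = s.real := rfl

theorem setReal_real (c : Cell) (v : ℝ) (a j : ℕ) :
    (s.setReal c v).real a j = if a = c.arr ∧ j = s.nat c.reg then v else s.real a j := by
  by_cases ha : a = c.arr <;> by_cases hj : j = s.nat c.reg <;>
    simp [setReal, Function.update, ha, hj]

theorem setNat_nat (r v r' : ℕ) :
    (s.setNat r v).nat r' = if r' = r then v else s.nat r' := by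
  simp [setNat, Function.update]

end State

/-! ### The program -/

/-- The cell of array `a` whose index is register `1`. -/
def entry (a : ℕ) : Cell := ⟨a, 1⟩

/-- Cell `0` of array `a`; register `9` is never written to. -/
def scalar (a : ℕ) : Cell := ⟨a, 9⟩

/-- Fills one coordinate of the next vertex. -/
def fillProg : Prog :=
  -- Memory: arrays 5, 6, 7 hold c, y, v; cell 0 of arrays 10, 11, 12, 13 holds W, θ, the remainder
  -- and Θ; arrays 16 and 17 hold the constants 1 and 0. Registers 1, 2, 3 are the coordinate, the
  -- round and the address in the output table; register 4 is 1. The outer test keeps the old vertex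
  -- when W = 0.
  .branch (.realLt (scalar 17) (scalar 10))
    (.branch (.realLt (entry 6) (scalar 10))
      (.branch (.realLt (scalar 17) (entry 6))
        (.branch (.realLt (scalar 12) (entry 5))
          (.seq (.realOp .div (entry 7) (scalar 12) (entry 5)) (.realCopy (scalar 12) (scalar 17)))
          (.seq (.realCopy (entry 7) (scalar 16))
            (.realOp .sub (scalar 12) (scalar 12) (entry 5))))
        (.realCopy (entry 7) (scalar 17)))
      (.realCopy (entry 7) (scalar 16)))
    .skip

def capLowerProg : Prog :=
  .branch (.realLt (scalar 17) (entry 7))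
    (.seq (.realOp .mul (scalar 14) (scalar 11) (entry 7))
      (.branch (.realLt (entry 6) (scalar 14)) (.realOp .div (scalar 11) (entry 6) (entry 7))
        .skip))
    .skip

def capUpperProg : Prog :=
  .branch (.realLt (entry 7) (scalar 16))
    (.seq (.realOp .sub (scalar 15) (scalar 16) (entry 7))
      (.seq (.realOp .mul (scalar 14) (scalar 11) (scalar 15))
        (.seq (.realOp .sub (scalar 19) (scalar 10) (entry 6))
          (.branch (.realLt (scalar 19) (scalar 14))
            (.realOp .div (scalar 11) (scalar 19) (scalar 15)) .skip))))
    .skip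

/-- Arrays for intermediate results. -/
def IsTemp (a : ℕ) : Prop := a = 14 ∨ a = 15 ∨ a = 19

instance (a : ℕ) : Decidable (IsTemp a) := inferInstanceAs (Decidable (_ ∨ _))

open VertexPeeling

section Blocks

variable {s : State}

theorem reaches_fillProg (h9 : s.nat 9 = 0) (h16 : s.real 16 0 = 1) (h17 : s.real 17 0 = 0)
    (hc : s.real 5 (s.nat 1) ≠ 0) :
    Reaches fillProg s 6 fun s' => s'.nat = s.nat ∧ ∀ a j, s'.real a j =
      if a = 7 ∧ j = s.nat 1 ∧ 0 < s.real 10 0 then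
        fillValue (s.real 5 (s.nat 1)) (s.real 6 (s.nat 1)) (s.real 10 0) (s.real 12 0)
      else if a = 12 ∧ j = 0 ∧ 0 < s.real 10 0 then
        fillNext (s.real 5 (s.nat 1)) (s.real 6 (s.nat 1)) (s.real 10 0) (s.real 12 0)
      else s.real a j := by
  unfold fillProg
  refine .branch (fun h1 => .branch (fun h2 => .branch (fun h3 => .branch
    (fun h4 => .seq (.realOp ?_ (.realCopy ?_))) (fun h4 => .seq (.realCopy (.realOp ?_ ?_))))
    (fun h3 => .le (.realCopy ?_) (by norm_num))) (fun h2 => .le (.realCopy ?_) (by norm_num)))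
    (fun h1 => .le (.skip ?_) (by norm_num))
  · exact hc
  · simp only [Test.Holds, State.get, entry, scalar, h9, h17] at h1 h2 h3 h4
    refine ⟨rfl, fun a j => ?_⟩
    simp [State.setReal_real, State.setReal_nat, State.get, entry, scalar, RealOp.eval, h9, h17,
      fillValue, fillNext, h1, h2, h3, h4]
    grind
  · trivial
  · simp only [Test.Holds, State.get, entry, scalar, h9, h17] at h1 h2 h3 h4
    refine ⟨rfl, fun a j => ?_⟩
    simp [State.setReal_real, State.setReal_nat, State.get, entry, scalar, RealOp.eval, h9, h16,
      fillValue, fillNext, h1, h2, h3, h4]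
    grind
  · simp only [Test.Holds, State.get, entry, scalar, h9, h17] at h1 h2 h3
    refine ⟨rfl, fun a j => ?_⟩
    simp [State.setReal_real, State.get, entry, scalar, h9, h17,
      fillValue, fillNext, h1, h2, h3]
    grind
  · simp only [Test.Holds, State.get, entry, scalar, h9, h17] at h1 h2
    refine ⟨rfl, fun a j => ?_⟩
    simp [State.setReal_real, State.get, entry, scalar, h9, h16,
      fillValue, fillNext, h1, h2]
    grind
  · simp only [Test.Holds, State.get, scalar, h9, h17] at h1
    exact ⟨rfl, fun a j => by simp [h1]⟩

theorem reaches_capLowerProg (h9 : s.nat 9 = 0) (h17 : s.real 17 0 = 0) :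
    Reaches capLowerProg s 4 fun s' => s'.nat = s.nat ∧ ∀ a j, ¬ IsTemp a → s'.real a j =
      if a = 11 ∧ j = 0 then capLower (s.real 6 (s.nat 1)) (s.real 7 (s.nat 1)) (s.real 11 0)
      else s.real a j := by
  unfold capLowerProg
  refine .branch (fun h1 => .seq (.realOp ?_ (.branch (fun h2 => .realOp ?_ ?_)
    (fun h2 => .skip ?_)))) (fun h1 => .le (.skip ?_) (by norm_num))
  · trivial
  all_goals simp [Test.Holds, State.get, entry, scalar, h9, h17, State.setReal_real,
    State.setReal_nat, RealOp.eval, RealOp.Defined] at *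
  · exact h1.ne'
  all_goals
    intro a j ha
    unfold IsTemp at ha
    simp only [capLower]
    grind

theorem reaches_capUpperProg (h9 : s.nat 9 = 0) (h16 : s.real 16 0 = 1) :
    Reaches capUpperProg s 6 fun s' => s'.nat = s.nat ∧ ∀ a j, ¬ IsTemp a → s'.real a j =
      if a = 11 ∧ j = 0 then
        capUpper (s.real 6 (s.nat 1)) (s.real 7 (s.nat 1)) (s.real 10 0) (s.real 11 0)
      else s.real a j := by
  unfold capUpperProg
  refine .branch (fun h1 => .seq (.realOp ?_ (.seq (.realOp ?_ (.seq (.realOp ?_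
    (.branch (fun h2 => .realOp ?_ ?_) (fun h2 => .skip ?_)))))))) (fun h1 => .le (.skip ?_) (by norm_num))
  · trivial
  · trivial
  · trivial
  all_goals simp [Test.Holds, State.get, entry, scalar, h9, h16, State.setReal_real,
    State.setReal_nat, RealOp.eval, RealOp.Defined] at *
  · exact sub_ne_zero.2 h1.ne'
  all_goals
    intro a j ha
    unfold IsTemp at ha
    simp only [capUpper]
    grind

end Blocks

end RealRAM

/-! ### The loop bodies of one round -/

namespace RealRAM

open VertexPeeling

/-- Subtracts the last vertex at one coordinate and updates the remainder. -/
def updateProg : Prog :=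
  .seq (.realOp .mul (scalar 14) (scalar 11) (entry 7))
    (.seq (.realOp .sub (entry 6) (entry 6) (scalar 14))
      (.seq (.branch (.realLt (entry 6) (scalar 10)) .skip
          (.realOp .sub (scalar 12) (scalar 12) (entry 5)))
        (.natOp .add 1 1 4)))

/-- Computes one coordinate of the next vertex, stores it, and updates its weight. -/
def vertexProg : Prog :=
  .seq fillProg (.seq (.realCopy ⟨4, 3⟩ (entry 7)) (.seq capLowerProg (.seq capUpperProg
    (.seq (.natOp .add 3 3 4) (.natOp .add 1 1 4)))))

theorem reaches_updateProg {s : State} (h9 : s.nat 9 = 0) (h4 : s.nat 4 = 1) :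
    Reaches updateProg s 5 fun s' =>
      (∀ r, s'.nat r = if r = 1 then s.nat 1 + 1 else s.nat r) ∧ ∀ a j, ¬ IsTemp a →
        s'.real a j = if a = 6 ∧ j = s.nat 1 then
          s.real 6 (s.nat 1) - s.real 11 0 * s.real 7 (s.nat 1)
        else if a = 12 ∧ j = 0 then s.real 12 0 -
          (if s.real 6 (s.nat 1) - s.real 11 0 * s.real 7 (s.nat 1) < s.real 10 0 then 0
            else s.real 5 (s.nat 1))
        else s.real a j := by
  unfold updateProg
  refine .seq (.realOp ?_ (.seq (.realOp ?_ (.seq (.branch (fun h1 => .skip (.natOp ?_))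
    (fun h1 => .realOp ?_ (.natOp ?_)))))))
  · trivial
  · trivial
  · simp [Test.Holds, State.get, entry, scalar, h9, State.setReal_real, State.setReal_nat,
      RealOp.eval] at h1
    refine ⟨fun r => by simp [State.setNat_nat, State.setReal_nat, NatOp.eval, h4],
      fun a j ha => ?_⟩
    unfold IsTemp at ha
    simp [State.setNat_real, State.setReal_real, State.setReal_nat, State.get, entry, scalar, h9,
      RealOp.eval, h1]
    grind
  · trivial
  · simp [Test.Holds, State.get, entry, scalar, h9, State.setReal_real, State.setReal_nat,
      RealOp.eval] at h1
    refine ⟨fun r => by simp [State.setNat_nat, State.setReal_nat, NatOp.eval, h4],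
      fun a j ha => ?_⟩
    unfold IsTemp at ha
    simp [State.setNat_real, State.setReal_real, State.setReal_nat, State.get, entry, scalar, h9,
      RealOp.eval, h1.not_gt]
    grind

theorem reaches_vertexProg {s : State} {c y v v' W θ R : ℝ} (h9 : s.nat 9 = 0)
    (h4 : s.nat 4 = 1) (h16 : s.real 16 0 = 1) (h17 : s.real 17 0 = 0)
    (hc : s.real 5 (s.nat 1) = c) (hc0 : c ≠ 0) (hy : s.real 6 (s.nat 1) = y)
    (hv : s.real 7 (s.nat 1) = v) (hW : s.real 10 0 = W) (hθ : s.real 11 0 = θ)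
    (hR : s.real 12 0 = R) (hv' : v' = if 0 < W then fillValue c y W R else v) :
    Reaches vertexProg s 19 fun s' =>
      (∀ r, s'.nat r = if r = 1 then s.nat 1 + 1 else if r = 3 then s.nat 3 + 1 else s.nat r) ∧
      ∀ a j, ¬ IsTemp a → s'.real a j =
        if a = 7 ∧ j = s.nat 1 then v'
        else if a = 12 ∧ j = 0 then (if 0 < W then fillNext c y W R else R)
        else if a = 4 ∧ j = s.nat 3 then v'
        else if a = 11 ∧ j = 0 then capUpper y v' W (capLower y v' θ)
        else s.real a j := by
  unfold vertexProg
  refine .le (K := 6 + (1 + (4 + (6 + (1 + 1))))) ?_ (by norm_num)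
  refine .seq ((reaches_fillProg h9 h16 h17 (by rw [hc]; exact hc0)).mono fun s₁ h₁ => ?_)
  rw [hc, hy, hW, hR] at h₁
  refine .seq (.realCopy ?_)
  obtain ⟨s₂, hs₂⟩ : ∃ s₂, s₂ = s₁.setReal ⟨4, 3⟩ (s₁.get (entry 7)) := ⟨_, rfl⟩
  rw [← hs₂]
  have hv₁ : s₁.real 7 (s.nat 1) = v' := by
    rw [h₁.2, hv', hv]
    by_cases h : 0 < W <;> simp [h]
  have hn₂ : s₂.nat = s.nat := by rw [hs₂]; exact h₁.1
  have hr₂ : ∀ a j, s₂.real a j = if a = 4 ∧ j = s.nat 3 then v' else s₁.real a j :=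
    fun a j => by
      rw [hs₂, State.setReal_real]
      simp only [State.get, entry, h₁.1, hv₁]
  refine .seq ((reaches_capLowerProg (by rw [hn₂]; exact h9)
    (by rw [hr₂, h₁.2]; simpa using h17)).mono fun s₃ h₃ => ?_)
  rw [hn₂] at h₃
  have hr₃ : ∀ a j, ¬ IsTemp a → s₃.real a j =
      if a = 11 ∧ j = 0 then capLower y v' θ else s₂.real a j := fun a j ha => by
    rw [h₃.2 a j ha]
    congr 2
    · rw [hr₂, h₁.2]; simpa using hy
    · rw [hr₂]; simpa using hv₁
    · rw [hr₂, h₁.2]; simpa using hθ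
  refine .seq ((reaches_capUpperProg (by rw [h₃.1]; exact h9)
    (by rw [hr₃ _ _ (by decide), hr₂, h₁.2]; simpa using h16)).mono fun s₄ h₄ => ?_)
  rw [h₃.1] at h₄
  have hr₄ : ∀ a j, ¬ IsTemp a → s₄.real a j =
      if a = 11 ∧ j = 0 then capUpper y v' W (capLower y v' θ) else s₂.real a j :=
    fun a j ha => by
      rw [h₄.2 a j ha, hr₃ a j ha, hr₃ _ _ (by decide), hr₃ _ _ (by decide), hr₃ _ _ (by decide),
        hr₃ _ _ (by decide)]
      simp only [Nat.reduceEqDiff, false_and, if_false, and_self, if_true, hr₂]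
      rw [hv₁, h₁.2, h₁.2]
      simp [hy, hW]
      grind
  refine .seq (.natOp (.natOp ⟨fun r => ?_, fun a j ha => ?_⟩))
  · simp only [State.setNat_nat, NatOp.eval, h₄.1, h4]
    grind
  · simp only [State.setNat_real]
    rw [hr₄ a j ha, hr₂, h₁.2, hv']
    grind

end RealRAM

/-! ### Initialisation, rounds and their invariants -/

namespace RealRAM

open VertexPeeling

/-- Computes the length and the weight of one battlefield. -/
def lottoProg : Prog :=
  .seq (.realOp .mul (scalar 14) ⟨2, 5⟩ (entry 1))
    (.seq (.branch (.realLt (entry 0) (scalar 14))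
        (.seq (.realCopy (entry 5) (entry 0)) (.realOp .div (entry 6) (entry 0) (scalar 14)))
        (.seq (.realCopy (entry 5) (scalar 14)) (.realCopy (entry 6) (scalar 16))))
      (.seq (.realOp .mul (scalar 14) (entry 5) (entry 6))
        (.seq (.realOp .add (scalar 13) (scalar 13) (scalar 14)) (.natOp .add 1 1 4))))

/-- Register 5 is the address of γ in array 2. The entries written to array 5 are λ times the
interval lengths; a common factor does not change the slice, so λ is never read. -/
def initProg : Prog :=
  .seq (.natConst 4 1) (.seq (.natConst 5 2) (.seq (.realConst (scalar 10) 1)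
    (.seq (.realConst (scalar 16) 1) (.loop (.natLt 1 0) lottoProg))))

/-- One round of the decomposition. -/
def roundProg : Prog :=
  .seq (.natConst 1 0) (.seq (.realOp .sub (scalar 10) (scalar 10) (scalar 11))
    (.seq (.realCopy (scalar 12) (scalar 13)) (.seq (.loop (.natLt 1 0) updateProg)
      (.seq (.natConst 1 0) (.seq (.realCopy (scalar 11) (scalar 10))
        (.seq (.loop (.natLt 1 0) vertexProg) (.seq (.realCopy ⟨3, 2⟩ (scalar 11))
          (.natOp .add 2 2 4))))))))

/-- The program which decomposes the weights of player `A`. -/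
def lottoDecomposition : Prog := .seq initProg (.loop (.natLt 2 0) roundProg)

theorem reaches_lottoProg {s : State} {A t : ℝ} (h9 : s.nat 9 = 0) (h4 : s.nat 4 = 1)
    (h16 : s.real 16 0 = 1) (hA : s.real 0 (s.nat 1) = A)
    (ht : s.real 2 (s.nat 5) * s.real 1 (s.nat 1) = t) (ht0 : 0 < t) :
    Reaches lottoProg s 7 fun s' =>
      (∀ r, s'.nat r = if r = 1 then s.nat 1 + 1 else s.nat r) ∧ ∀ a j, ¬ IsTemp a →
        s'.real a j = if a = 5 ∧ j = s.nat 1 then min A t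
        else if a = 6 ∧ j = s.nat 1 then (if A < t then A / t else 1)
        else if a = 13 ∧ j = 0 then s.real 13 0 + min A t * (if A < t then A / t else 1)
        else s.real a j := by
  unfold lottoProg
  refine .le (K := 1 + (2 + 1 + (1 + (1 + 1)))) ?_ (by norm_num)
  refine .seq (.realOp trivial (.seq (.branch
    (fun h1 => .le (K := 1 + 1) (.seq (.realCopy (.realOp ?_
      (.seq (.realOp trivial (.seq (.realOp trivial (.natOp ?_)))))))) (by norm_num))
    (fun h1 => .le (K := 1 + 1) (.seq (.realCopy (.realCopy
      (.seq (.realOp trivial (.seq (.realOp trivial (.natOp ?_)))))))) (by norm_num)))))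
  · simp [State.get, entry, scalar, h9, State.setReal_real, State.setReal_nat,
      RealOp.eval, RealOp.Defined]
    have := ht0.ne'
    rw [← ht] at this
    exact not_or.1 (mt mul_eq_zero.2 this)
  · simp [Test.Holds, State.get, entry, scalar, h9, State.setReal_real, State.setReal_nat,
      RealOp.eval, hA, ht] at h1
    refine ⟨fun r => by simp [State.setNat_nat, State.setReal_nat, NatOp.eval, h4],
      fun a j ha => ?_⟩
    unfold IsTemp at ha
    simp [State.setNat_real, State.setReal_real, State.setReal_nat, State.get, entry, scalar, h9,
      RealOp.eval, h1, hA, ht, min_eq_left h1.le]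
    grind
  · simp [Test.Holds, State.get, entry, scalar, h9, State.setReal_real, State.setReal_nat,
      RealOp.eval, hA, ht] at h1
    refine ⟨fun r => by simp [State.setNat_nat, State.setReal_nat, NatOp.eval, h4],
      fun a j ha => ?_⟩
    unfold IsTemp at ha
    simp [State.setNat_real, State.setReal_real, State.setReal_nat, State.get, entry, scalar, h9,
      h16, RealOp.eval, h1.not_gt, ht, min_eq_right h1]
    grind

/-- The constants kept in memory. -/
structure Constants (n : ℕ) (c : ℕ → ℝ) (Θ : ℝ) (s : State) : Prop where
  nat0 : s.nat 0 = n
  nat4 : s.nat 4 = 1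
  nat9 : s.nat 9 = 0
  real5 : ∀ m < n, s.real 5 m = c m
  real13 : s.real 13 0 = Θ
  real16 : s.real 16 0 = 1
  real17 : s.real 17 0 = 0

/-- The first `k` rounds have been written to the output. -/
structure Written (n k : ℕ) (st : ℕ → Stage) (s : State) : Prop where
  nat2 : s.nat 2 = k
  real3 : ∀ m < k, s.real 3 m = (st (m + 1)).θ
  real4 : ∀ m < k, ∀ i < n, s.real 4 (m * n + i) = (st (m + 1)).v i

/-- The memory after `k` rounds. -/
structure RoundInv (n : ℕ) (c : ℕ → ℝ) (Θ : ℝ) (st : ℕ → Stage) (k : ℕ) (s : State) : Prop where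
  const : Constants n c Θ s
  out : Written n k st s
  nat3 : s.nat 3 = k * n
  real6 : ∀ m < n, s.real 6 m = (st k).y m
  real7 : ∀ m < n, s.real 7 m = (st k).v m
  real10 : s.real 10 0 = (st k).W
  real11 : s.real 11 0 = (st k).θ

structure UpdateInv (n : ℕ) (c : ℕ → ℝ) (Θ : ℝ) (st : ℕ → Stage) (k j : ℕ) (s : State) :
    Prop where
  const : Constants n c Θ s
  out : Written n k st s
  nat1 : s.nat 1 = j
  nat3 : s.nat 3 = k * n
  real6 : ∀ m < n, s.real 6 m = if m < j then (st k).rest m else (st k).y m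
  real7 : ∀ m < n, s.real 7 m = (st k).v m
  real10 : s.real 10 0 = (st k).weight
  real11 : s.real 11 0 = (st k).θ
  real12 : s.real 12 0 =
    Θ - ∑ m ∈ Finset.range j, if (st k).rest m < (st k).weight then 0 else c m

/-- The remainder is described only while weight is left, as the filling step is skipped otherwise.
-/
structure VertexInv (n : ℕ) (c : ℕ → ℝ) (Θ : ℝ) (st : ℕ → Stage) (k j : ℕ) (s : State) :
    Prop where
  const : Constants n c Θ s
  out : Written n k st s
  nat1 : s.nat 1 = j
  nat3 : s.nat 3 = k * n + j
  real6 : ∀ m < n, s.real 6 m = (st k).rest m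
  real7 : ∀ m < n, s.real 7 m = if m < j then (st k).vertex n c Θ m else (st k).v m
  real10 : s.real 10 0 = (st k).weight
  real11 : s.real 11 0 = cap (st k).rest ((st k).vertex n c Θ) (st k).weight j
  real12 : 0 < (st k).weight → s.real 12 0 =
    fillRem c (st k).rest (st k).weight (slack n c (st k).rest (st k).weight Θ) j
  real4 : ∀ i < j, s.real 4 (k * n + i) = (st k).vertex n c Θ i

section Loops

variable {n k : ℕ} {c : ℕ → ℝ} {Θ : ℝ} {st : ℕ → Stage}

/-- Writing row k of the output table leaves the earlier rows intact. -/
theorem mul_add_lt_mul {m i : ℕ} (hm : m < k) (hi : i < n) : m * n + i < k * n :=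
  calc m * n + i < m * n + n := by omega
    _ = (m + 1) * n := by ring
    _ ≤ k * n := Nat.mul_le_mul_right _ hm

theorem UpdateInv.step {j : ℕ} (hj : j < n) {s : State} (h : UpdateInv n c Θ st k j s) :
    Reaches updateProg s 5 (UpdateInv n c Θ st k (j + 1)) := by
  obtain ⟨⟨c0, c4, c9, c5, c13, c16, c17⟩, ⟨o2, o3, o4⟩, h1, h3, h6, h7, h10, h11, h12⟩ := h
  have hy := h6 j hj
  rw [if_neg (lt_irrefl _)] at hy
  refine (reaches_updateProg c9 c4).mono fun s' ⟨hn, hr⟩ => ?_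
  rw [h1, hy, h7 j hj, h10, h11, c5 j hj, h12] at hr
  rw [h1] at hn
  change ∀ a i, ¬ IsTemp a → s'.real a i = if a = 6 ∧ i = j then (st k).rest j else
    if a = 12 ∧ i = 0 then _ - (if (st k).rest j < (st k).weight then 0 else c j)
    else s.real a i at hr
  refine ⟨⟨?_, ?_, ?_, fun m hm => ?_, ?_, ?_, ?_⟩, ⟨?_, fun m hm => ?_, fun m hm i hi => ?_⟩,
    ?_, ?_, fun m hm => ?_, fun m hm => ?_, ?_, ?_, ?_⟩
  · simp [hn, c0]
  · simp [hn, c4]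
  · simp [hn, c9]
  · rw [hr _ _ (by decide)]; simp [c5 m hm]
  · rw [hr _ _ (by decide)]; simp [c13]
  · rw [hr _ _ (by decide)]; simp [c16]
  · rw [hr _ _ (by decide)]; simp [c17]
  · simp [hn, o2]
  · rw [hr _ _ (by decide)]; simp [o3 m hm]
  · rw [hr _ _ (by decide)]; simp [o4 m hm i hi]
  · simp [hn]
  · simp [hn, h3]
  · rw [hr _ _ (by decide), h6 m hm]
    grind
  · rw [hr _ _ (by decide)]; simp [h7 m hm]
  · rw [hr _ _ (by decide)]; simp [h10]
  · rw [hr _ _ (by decide)]; simp [h11]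
  · rw [hr _ _ (by decide), Finset.sum_range_succ]
    simp
    ring

theorem VertexInv.step {j : ℕ} (hj : j < n) (hc : ∀ i < n, 0 < c i) {s : State}
    (h : VertexInv n c Θ st k j s) :
    Reaches vertexProg s 19 (VertexInv n c Θ st k (j + 1)) := by
  obtain ⟨⟨c0, c4, c9, c5, c13, c16, c17⟩, ⟨o2, o3, o4⟩, h1, h3, h6, h7, h10, h11, h12, h4⟩ := h
  have hy : s.real 6 (s.nat 1) = (st k).rest j := by rw [h1, h6 j hj]
  have hv : s.real 7 (s.nat 1) = (st k).v j := by rw [h1, h7 j hj, if_neg (lt_irrefl _)]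
  have hc5 : s.real 5 (s.nat 1) = c j := by rw [h1, c5 j hj]
  have hv' : (st k).vertex n c Θ j = if 0 < (st k).weight then
      fillValue (c j) ((st k).rest j) (st k).weight (s.real 12 0) else (st k).v j := by
    unfold Stage.vertex
    split_ifs with hW
    · rw [h12 hW]; rfl
    · rfl
  refine (reaches_vertexProg c9 c4 c16 c17 hc5 (hc j hj).ne' hy hv h10 h11 rfl hv').mono
    fun s' ⟨hn, hr⟩ => ?_
  rw [h1, h3] at hr hn
  refine ⟨⟨?_, ?_, ?_, fun m hm => ?_, ?_, ?_, ?_⟩, ⟨?_, fun m hm => ?_, fun m hm i hi => ?_⟩,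
    ?_, ?_, fun m hm => ?_, fun m hm => ?_, ?_, ?_, fun hW => ?_, fun i hi => ?_⟩
  · simp [hn, c0]
  · simp [hn, c4]
  · simp [hn, c9]
  · rw [hr _ _ (by decide)]; simp [c5 m hm]
  · rw [hr _ _ (by decide)]; simp [c13]
  · rw [hr _ _ (by decide)]; simp [c16]
  · rw [hr _ _ (by decide)]; simp [c17]
  · simp [hn, o2]
  · rw [hr _ _ (by decide)]; simp [o3 m hm]
  · have := mul_add_lt_mul hm hi
    have h' : m * n + i ≠ k * n + j := by omega
    rw [hr _ _ (by decide)]; simp [o4 m hm i hi, h']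
  · simp [hn]
  · simp [hn, add_assoc]
  · rw [hr _ _ (by decide)]; simp [h6 m hm]
  · rw [hr _ _ (by decide), h7 m hm]
    grind
  · rw [hr _ _ (by decide)]; simp [h10]
  · rw [hr _ _ (by decide)]; simp [cap]
  · rw [hr _ _ (by decide)]; simp [hW, fillRem, h12 hW]
  · rw [hr _ _ (by decide)]
    rcases Nat.lt_succ_iff_lt_or_eq.1 hi with hi' | rfl
    · simp [h4 i hi', hi'.ne]
    · simp

theorem RoundInv.step (hc : ∀ i < n, 0 < c i) (hst : st (k + 1) = (st k).next n c Θ) {s : State}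
    (h : RoundInv n c Θ st k s) :
    Reaches roundProg s (26 * n + 9) (RoundInv n c Θ st (k + 1)) := by
  obtain ⟨⟨c0, c4, c9, c5, c13, c16, c17⟩, ⟨o2, o3, o4⟩, h3, h6, h7, h10, h11⟩ := h
  unfold roundProg
  refine .le (K := 1 + (1 + (1 + ((n * (5 + 1) + 1) + (1 + (1 + ((n * (19 + 1) + 1) +
    (1 + 1)))))))) ?_ (by ring_nf; rfl)
  refine .seq (.natConst (.seq (.realOp trivial (.seq (.realCopy (.seq ?_))))))
  refine (Reaches.forLoop (Inv := UpdateInv n c Θ st k) (fun j s h => ⟨h.const.nat0, h.nat1⟩)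
    (fun j hj s h => h.step hj) ?_).mono fun s₁ h₁ => ?_
  · refine ⟨⟨?_, ?_, ?_, fun m hm => ?_, ?_, ?_, ?_⟩,
      ⟨?_, fun m hm => ?_, fun m hm i hi => ?_⟩, ?_, ?_, fun m hm => ?_, fun m hm => ?_, ?_, ?_, ?_⟩
    all_goals simp [State.setReal_nat, State.setNat_nat, State.setNat_real, State.setReal_real,
      State.get, scalar, RealOp.eval, *, Stage.weight]
  clear c0 c4 c9 c5 c13 c16 c17 o2 o3 o4 h3 h6 h7 h10 h11
  obtain ⟨⟨c0, c4, c9, c5, c13, c16, c17⟩, ⟨o2, o3, o4⟩, h1, h3, h6, h7, h10, h11, h12⟩ := h₁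
  refine .seq (.natConst (.seq (.realCopy (.seq ?_))))
  refine (Reaches.forLoop (Inv := VertexInv n c Θ st k) (fun j s h => ⟨h.const.nat0, h.nat1⟩)
    (fun j hj s h => h.step hj hc) ?_).mono fun s₂ h₂ => ?_
  · refine ⟨⟨?_, ?_, ?_, fun m hm => ?_, ?_, ?_, ?_⟩,
      ⟨?_, fun m hm => ?_, fun m hm i hi => ?_⟩, ?_, ?_, fun m hm => ?_, fun m hm => ?_, ?_, ?_,
      fun _ => ?_, fun i hi => ?_⟩
    rotate_right
    · omega
    all_goals simp [State.setReal_nat, State.setNat_nat, State.setNat_real, State.setReal_real,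
      State.get, scalar, *, cap, fillRem, slack]
  clear c0 c4 c9 c5 c13 c16 c17 o2 o3 o4 h1 h3 h6 h7 h10 h11 h12
  obtain ⟨⟨c0, c4, c9, c5, c13, c16, c17⟩, ⟨o2, o3, o4⟩, h1, h3, h6, h7, h10, h11, h12, h4⟩ := h₂
  refine .seq (.realCopy (.natOp ?_))
  refine ⟨⟨?_, ?_, ?_, fun m hm => ?_, ?_, ?_, ?_⟩,
      ⟨?_, fun m hm => ?_, fun m hm i hi => ?_⟩, ?_, fun m hm => ?_, fun m hm => ?_, ?_, ?_⟩
  rotate_left 8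
  · rcases Nat.lt_succ_iff_lt_or_eq.1 hm with hm' | rfl
    · simp [State.setReal_nat, State.setNat_real, State.setReal_real, o2, hm'.ne, o3 m hm']
    · simp [State.setNat_real, State.setReal_real, State.get, scalar, o2, c9, h11, hst, Stage.next]
  · rcases Nat.lt_succ_iff_lt_or_eq.1 hm with hm' | rfl
    · simp [State.setNat_real, State.setReal_real, o4 m hm' i hi]
    · simp [State.setNat_real, State.setReal_real, h4 i hi, hst, Stage.next]
  · simp [State.setReal_nat, State.setNat_nat, h3]; ring
  all_goals simp [State.setReal_nat, State.setNat_nat, State.setNat_real, State.setReal_real,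
      NatOp.eval, *, Stage.next]

end Loops

end RealRAM

/-! ### The whole run of the program -/

namespace RealRAM

open VertexPeeling

/-- The memory after the lengths and weights of `j` battlefields have been computed. -/
structure InitInv (n : ℕ) (A B : ℕ → ℝ) (g : ℝ) (c x : ℕ → ℝ) (j : ℕ) (s : State) : Prop where
  -- Array 5 is only partly filled here, so it is compared with itself; `real5` below records the
  -- finished part.
  const : Constants n (fun m => s.real 5 m) (∑ m ∈ Finset.range j, c m * x m) s
  nat1 : s.nat 1 = j
  nat2 : s.nat 2 = 0
  nat3 : s.nat 3 = 0
  nat5 : s.nat 5 = 2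
  real0 : ∀ m < n, s.real 0 m = A m
  real1 : ∀ m < n, s.real 1 m = B m
  real2 : s.real 2 2 = g
  real5 : ∀ m < j, s.real 5 m = c m
  real6 : ∀ m < j, s.real 6 m = x m
  real7 : ∀ m, s.real 7 m = 0
  real10 : s.real 10 0 = 1
  real11 : s.real 11 0 = 0

theorem InitInv.step {n : ℕ} {A B : ℕ → ℝ} {g : ℝ} {c x : ℕ → ℝ}
    (hpos : ∀ m < n, 0 < g * B m) (hc : ∀ m < n, c m = min (A m) (g * B m))
    (hx : ∀ m < n, x m = if A m < g * B m then A m / (g * B m) else 1) {j : ℕ} (hj : j < n)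
    {s : State} (h : InitInv n A B g c x j s) :
    Reaches lottoProg s 7 (InitInv n A B g c x (j + 1)) := by
  obtain ⟨⟨c0, c4, c9, -, c13, c16, c17⟩, h1, h2, h3, h5, r0, r1, r2, r5, r6, r7, r10, r11⟩ := h
  have hA : s.real 0 (s.nat 1) = A j := by rw [h1, r0 j hj]
  have ht : s.real 2 (s.nat 5) * s.real 1 (s.nat 1) = g * B j := by rw [h5, h1, r2, r1 j hj]
  refine (reaches_lottoProg c9 c4 c16 hA ht (hpos j hj)).mono fun s' ⟨hn, hr⟩ => ?_
  rw [h1, ← hc j hj, ← hx j hj, c13] at hr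
  rw [h1] at hn
  refine ⟨⟨?_, ?_, ?_, fun m hm => rfl, ?_, ?_, ?_⟩, ?_, ?_, ?_, ?_, fun m hm => ?_,
    fun m hm => ?_, ?_, fun m hm => ?_, fun m hm => ?_, fun m => ?_, ?_, ?_⟩
  · simp [hn, c0]
  · simp [hn, c4]
  · simp [hn, c9]
  · rw [hr _ _ (by decide), Finset.sum_range_succ]; simp
  · rw [hr _ _ (by decide)]; simp [c16]
  · rw [hr _ _ (by decide)]; simp [c17]
  · simp [hn]
  · simp [hn, h2]
  · simp [hn, h3]
  · simp [hn, h5]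
  · rw [hr _ _ (by decide)]; simp [r0 m hm]
  · rw [hr _ _ (by decide)]; simp [r1 m hm]
  · rw [hr _ _ (by decide)]; simp [r2]
  · rw [hr _ _ (by decide)]
    rcases Nat.lt_succ_iff_lt_or_eq.1 hm with hm' | rfl
    · simp [r5 m hm', hm'.ne]
    · simp
  · rw [hr _ _ (by decide)]
    rcases Nat.lt_succ_iff_lt_or_eq.1 hm with hm' | rfl
    · simp [r6 m hm', hm'.ne]
    · simp
  · rw [hr _ _ (by decide)]; simp [r7]
  · rw [hr _ _ (by decide)]; simp [r10]
  · rw [hr _ _ (by decide)]; simp [r11]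

theorem ofVec_apply {n : ℕ} (v : Fin n → ℝ) {m : ℕ} (hm : m < n) : ofVec v m = v ⟨m, hm⟩ := by
  simp [ofVec, hm]

theorem reaches_lottoDecomposition {n : ℕ} (G : BlottoGame n) {g l : ℝ} (hg : 0 < g) :
    Reaches lottoDecomposition (input G g l) (26 * n ^ 2 + 18 * n + 6) (RoundInv n
      (ofVec fun i => min (G.vA i) (g * G.vB i))
      (∑ m ∈ Finset.range n, ofVec (fun i => min (G.vA i) (g * G.vB i)) m *
        ofVec (G.lottoWeightA g) m)
      (Stage.iter n (ofVec fun i => min (G.vA i) (g * G.vB i)) (ofVec (G.lottoWeightA g))) n) := by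
  obtain ⟨c, hc⟩ : ∃ c, c = ofVec fun i => min (G.vA i) (g * G.vB i) := ⟨_, rfl⟩
  obtain ⟨x, hx⟩ : ∃ x, x = ofVec (G.lottoWeightA g) := ⟨_, rfl⟩
  rw [← hc, ← hx]
  have hB : ∀ m < n, 0 < g * ofVec G.vB m := fun m hm => by
    rw [ofVec_apply _ hm]; exact mul_pos hg (G.vB_pos _)
  have hc' : ∀ m < n, c m = min (ofVec G.vA m) (g * ofVec G.vB m) := fun m hm => by
    rw [hc, ofVec_apply _ hm, ofVec_apply _ hm, ofVec_apply _ hm]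
  have hx' : ∀ m < n, x m = if ofVec G.vA m < g * ofVec G.vB m then
      ofVec G.vA m / (g * ofVec G.vB m) else 1 := fun m hm => by
    rw [hx, ofVec_apply _ hm, ofVec_apply _ hm, ofVec_apply _ hm]; rfl
  have hc0 : ∀ m < n, 0 < c m := fun m hm => by
    rw [hc' m hm]
    refine lt_min ?_ (hB m hm)
    rw [ofVec_apply _ hm]
    exact G.vA_pos _
  refine .le (K := (1 + (1 + (1 + (1 + (n * (7 + 1) + 1))))) + (n * (26 * n + 9 + 1) + 1)) ?_
    (by ring_nf; rfl)
  refine .seq (.seq (.natConst (.seq (.natConst (.seq (.realConst (.seq (.realConst ?_))))))))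
  refine (Reaches.forLoop (Inv := InitInv n (ofVec G.vA) (ofVec G.vB) g c x)
    (fun j s h => ⟨h.const.nat0, h.nat1⟩) (fun j hj s h => h.step hB hc' hx' hj) ?_).mono
    fun s₁ h₁ => ?_
  · constructor
    · constructor <;> simp [State.setReal_nat, State.setNat_nat, State.setNat_real,
        State.setReal_real, scalar, input]
    all_goals simp [State.setReal_nat, State.setNat_nat, State.setNat_real,
        State.setReal_real, scalar, input, ofVec]
  · refine Reaches.forLoop (fun k s h => ⟨h.const.nat0, h.out.nat2⟩)
      (fun k _ s h => h.step hc0 rfl) ?_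
    obtain ⟨⟨c0, c4, c9, -, c13, c16, c17⟩, h1, h2, h3, h5, r0, r1, r2, r5, r6, r7, r10, r11⟩ := h₁
    exact ⟨⟨c0, c4, c9, r5, c13, c16, c17⟩, ⟨h2, fun m hm => absurd hm (by omega),
      fun m hm => absurd hm (by omega)⟩, by rw [h3, zero_mul], r6, fun m _ => r7 m, r10, r11⟩

end RealRAM

/-! ### Assembling the couplings and the equilibrium -/

open VertexPeeling in
/-- The decomposition of a weight vector, for vectors indexed by `Fin n`. -/
theorem iter_decomposition_fin {n : ℕ} (hn : n ≠ 0) {c x : Fin n → ℝ} (hc : ∀ i, 0 < c i)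
    (hx : ∀ i, 0 ≤ x i ∧ x i ≤ 1) {q : Fin n → ℝ} {p : Fin n → Fin n → ℝ}
    (hq : ∀ k : Fin n, q k =
      (Stage.iter n (RealRAM.ofVec c) (RealRAM.ofVec x) (k + 1)).θ)
    (hp : ∀ k i : Fin n, p k i =
      (Stage.iter n (RealRAM.ofVec c) (RealRAM.ofVec x) (k + 1)).v i) :
    (∀ k, 0 ≤ q k) ∧ ∑ k, q k = 1 ∧ (∀ k i, 0 ≤ p k i ∧ p k i ≤ 1) ∧
      (∀ k, {i | 0 < p k i ∧ p k i < 1}.Subsingleton) ∧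
      (∀ k, ∑ i, p k i * c i = ∑ i, x i * c i) ∧ ∀ i, ∑ k, q k * p k i = x i := by
  have happ : ∀ (v : Fin n → ℝ) (i : Fin n), RealRAM.ofVec v i = v i := fun v i => by
    simp [RealRAM.ofVec]
  obtain ⟨h1, h2, h3, h4⟩ := Stage.iter_decomposition (n := n) (c := RealRAM.ofVec c)
    (x := RealRAM.ofVec x) hn (fun i hi => by rw [RealRAM.ofVec_apply _ hi]; exact hc _)
    (fun i hi => by rw [RealRAM.ofVec_apply _ hi]; exact hx _)
  rw [Finset.sum_range] at h2
  refine ⟨fun k => ?_, ?_, fun k i => ?_, fun k i hi j hj => ?_, fun k => ?_, fun i => ?_⟩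
  · rw [hq]; exact h1 k k.2
  · simpa only [hq] using h2
  · rw [hp]; exact (h3 k k.2).mem i i.2
  · simp only [Set.mem_ofPred_eq, hp] at hi hj
    exact Fin.ext ((h3 k k.2).sub i i.2 j j.2 hi.1 hi.2 hj.1 hj.2)
  · have h := (h3 k k.2).sum
    rw [Finset.sum_range, Finset.sum_range] at h
    simp only [happ] at h
    simp only [hp, mul_comm _ (c _)]
    exact h
  · have h := h4 i i.2
    rw [Finset.sum_range, happ] at h
    simpa only [hq, hp] using h

/-- The law with weight p and fixed length b is affine in p, so averaging the vertices averages the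
marginals. All the couplings have the same sum T, hence so does their mixture. -/
theorem exists_coupling_of_decomposition {n : ℕ} [NeZero n] {b x : Fin n → ℝ} {T : ℝ}
    (hb0 : ∀ i, 0 < b i) (hb : ∀ i, b i ≤ T) (hx : ∑ i, x i * b i = 2 * T) {q : Fin n → ℝ}
    {p : Fin n → Fin n → ℝ} (hq0 : ∀ k, 0 ≤ q k) (hq1 : ∑ k, q k = 1)
    (hp : ∀ k i, 0 ≤ p k i ∧ p k i ≤ 1) (hfrac : ∀ k, {i | 0 < p k i ∧ p k i < 1}.Subsingleton)
    (hpb : ∀ k, ∑ i, p k i * b i = ∑ i, x i * b i) (hpx : ∀ i, ∑ k, q k * p k i = x i) :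
    ∃ π : Fin n → Measure (Fin n → ℝ),
      (∀ k, IsCoupling (π k) (fun i => zeroUnifMix (p k i) (b i))) ∧
      (∀ k, ∀ᵐ y ∂π k, ∑ i, y i = T) ∧
      IsCoupling (∑ k, ENNReal.ofReal (q k) • π k) (fun i => zeroUnifMix (x i) (b i)) ∧
      ∀ᵐ y ∂(∑ k, ENNReal.ofReal (q k) • π k), ∑ i, y i = T := by
  choose π h1 h2 using fun k => exists_coupling_of_subsingleton hb0 hb (hp k) (hfrac k)
    ((hpb k).trans hx)
  refine ⟨π, h1, h2, ⟨mixture_isProb hq0 hq1 fun k => (h1 k).isProb, fun i => ?_⟩,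
    mixture_ae h2⟩
  rw [mixture_map _ _ (measurable_pi_apply i)]
  simp only [(h1 _).marginal, zeroUnifMix, smul_add, smul_smul, Finset.sum_add_distrib,
    ← Finset.sum_smul]
  have e1 : ∑ k, ENNReal.ofReal (q k) * ENNReal.ofReal (p k i) = ENNReal.ofReal (x i) := by
    rw [← hpx i, ENNReal.ofReal_sum_of_nonneg fun k _ => mul_nonneg (hq0 k) (hp k i).1]
    exact Finset.sum_congr rfl fun k _ => (ENNReal.ofReal_mul (hq0 k)).symm
  have e2 : ∑ k, ENNReal.ofReal (q k) * ENNReal.ofReal (1 - p k i) =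
      ENNReal.ofReal (1 - x i) := by
    have : 1 - x i = ∑ k, q k * (1 - p k i) := by
      simp only [mul_sub, mul_one, Finset.sum_sub_distrib, hpx, hq1]
    rw [this, ENNReal.ofReal_sum_of_nonneg fun k _ =>
      mul_nonneg (hq0 k) (sub_nonneg.2 (hp k i).2)]
    exact Finset.sum_congr rfl fun k _ => (ENNReal.ofReal_mul (hq0 k)).symm
  rw [e1, e2]

/-- For n ≥ 2 the quadratic is at most 50 n^2, and log n ≥ log 2 pays for the logarithm. -/
theorem step_bound {n : ℕ} (hn : 2 ≤ n) {t : ℕ} (ht : t ≤ 26 * n ^ 2 + 18 * n + 6) :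
    (t : ℝ) ≤ 50 / Real.log 2 * ((n : ℝ) ^ 2 * Real.log n) := by
  have hn' : (2 : ℝ) ≤ n := by exact_mod_cast hn
  have h2 : 0 < Real.log 2 := Real.log_pos (by norm_num)
  have hlog : Real.log 2 ≤ Real.log n := Real.log_le_log (by norm_num) hn'
  have ht' : (t : ℝ) ≤ 26 * n ^ 2 + 18 * n + 6 := by exact_mod_cast ht
  calc (t : ℝ) ≤ 50 * (n : ℝ) ^ 2 := by nlinarith
    _ = 50 / Real.log 2 * ((n : ℝ) ^ 2 * Real.log 2) := by field_simp
    _ ≤ _ := by gcongr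

theorem mainTheorem8 :
    ∃ (prog : RealRAM.Prog) (C : ℝ), ∀ (n : ℕ) (G : BlottoGame n) (g l : ℝ), 2 ≤ n →
      G.IsLottoParam g l →
      (∀ i, min (g * G.vB i) (G.vA i) ≤ l * G.TB) →
      ∃ (π : Fin n → Measure (Fin n → ℝ)) (q : Fin n → ℝ) (p : Fin n → Fin n → ℝ),
        (∀ k, 0 ≤ q k) ∧ ∑ k, q k = 1 ∧
        -- the marginals of the couplings `π k`
        (∀ k i, 0 ≤ p k i ∧ p k i ≤ 1) ∧
        (∀ k, {i | 0 < p k i ∧ p k i < 1}.Subsingleton) ∧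
        (∀ k, IsCoupling (π k) (fun i => zeroUnifMix (p k i) (min (G.vA i) (g * G.vB i) / l))) ∧
        -- each `π k` is a joint mix
        (∀ k, IsJointMix (π k)) ∧
        -- the mixture couples the Lotto marginals of player `A`, is a joint mix, and is an
        -- equilibrium strategy against a coupling of the Lotto marginals of player `B`
        IsCoupling (∑ k, ENNReal.ofReal (q k) • π k) (G.lottoMarginalA g l) ∧
        IsJointMix (∑ k, ENNReal.ofReal (q k) • π k) ∧
        (∃ ν : Measure (Fin n → ℝ), IsCoupling ν (G.lottoMarginalB g l) ∧
          ∀ τ : Fin n → ℝ, (∀ i, 0 ≤ τ i ∧ τ i ≤ 1) →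
            G.IsBlottoNash τ (∑ k, ENNReal.ofReal (q k) • π k) ν) ∧
        -- the program computes all the weights within `C n² log n` steps
        (∃ (t : ℕ) (s : RealRAM.State), RealRAM.Exec prog (RealRAM.input G g l) t s ∧
          RealRAM.IsOutput s q p ∧ (t : ℝ) ≤ C * ((n : ℝ) ^ 2 * Real.log n)) := by
  refine ⟨RealRAM.lottoDecomposition, 50 / Real.log 2, fun n G g l hn hpar hmix => ?_⟩
  have hg := hpar.g_pos
  have hl := hpar.l_pos
  have hn0 : n ≠ 0 := by omega
  have : NeZero n := ⟨hn0⟩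
  obtain ⟨t, ht, s, hexec, hs⟩ := RealRAM.reaches_lottoDecomposition G (l := l) hg
  have hb0 := G.lottoLength_pos hg hl
  have hbB : ∀ i, G.lottoLength g l i ≤ G.TB := fun i => by
    rw [BlottoGame.lottoLength, div_le_iff₀ hl, min_comm, mul_comm G.TB]
    exact hmix i
  have hc0 : ∀ i, 0 < min (G.vA i) (g * G.vB i) := fun i =>
    lt_min (G.vA_pos i) (mul_pos hg (G.vB_pos i))
  have hscale : ∀ u v : Fin n → ℝ, ∑ i, u i * min (G.vA i) (g * G.vB i) =
      ∑ i, v i * min (G.vA i) (g * G.vB i) →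
      ∑ i, u i * G.lottoLength g l i = ∑ i, v i * G.lottoLength g l i := fun u v h => by
    simp only [BlottoGame.lottoLength, ← mul_div_assoc, ← Finset.sum_div, h]
  -- Player B's coupling comes from the same decomposition applied to B's weights; only its
  -- existence matters.
  have hB := iter_decomposition_fin hn0 hc0 (G.lottoWeightB_mem hg) (fun _ => rfl)
    (fun _ _ => rfl)
  obtain ⟨b1, b2, b3, b4, b5, b6⟩ := hB
  obtain ⟨ν, -, -, hν, hνT⟩ := exists_coupling_of_decomposition hb0 hbB (G.sum_lottoWeightB hpar)
    b1 b2 b3 b4 (fun k => hscale _ _ (b5 k)) b6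
  -- For player A the weights are read off the final memory, so the output clause holds by
  -- definition.
  obtain ⟨a1, a2, a3, a4, a5, a6⟩ := iter_decomposition_fin hn0 hc0 (G.lottoWeightA_mem hg)
    (fun k => hs.out.real3 k k.2) (fun k i => hs.out.real4 k k.2 i i.2)
  obtain ⟨π, hπ, hπT, hμ, hμT⟩ := exists_coupling_of_decomposition hb0
    (fun i => (hbB i).trans G.TB_le_TA) (G.sum_lottoWeightA hpar) a1 a2 a3 a4
    (fun k => hscale _ _ (a5 k)) a6
  refine ⟨π, _, _, a1, a2, a3, a4, hπ, fun k => (hπ k).isJointMix hb0 (hπT k), ?_,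
    hμ.isJointMix hb0 hμT, ⟨_, ?_, fun τ hτ => G.isBlottoNash_of_isCoupling hg hl hτ hμ hν hμT hνT⟩,
    t, s, hexec, ⟨fun _ => rfl, fun _ _ => rfl⟩, step_bound hn ht⟩
  · exact (funext fun i => G.lottoMarginalA_eq i : G.lottoMarginalA g l = _) ▸ hμ
  · exact (funext fun i => G.lottoMarginalB_eq i : G.lottoMarginalB g l = _) ▸ hν
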